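/- **Setting.** Let $0\le p_d\le 1$ and $\sigma>0$; all information quantities are in bits ($\log=\log_2$, $0\log 0=0$). In the deletion-AWGN channel, an input block $X=(x_1,\dots,x_N)\in\{0,1\}^N$ first passes through an i.i.d. deletion channel, which deletes every bit independently with probability $p_d$ and keeps the surviving bits in order; every surviving bit $x$ is then received as $(1-2x)+z$ (BPSK), where the noise variables $z$ are i.i.d. $\mathcal N(0,\sigma^2)$, independent of the deletions and of the input. The output $\widetilde Y$ is the resulting real sequence, of random length between $0$ and $N$; the positions of the deletions are not revealed. The (information) capacity of this channel is $$C_{d,\mathrm{AWGN}}=\lim_{N\to\infty}\frac1N\max_{P(X)}I(X;\widetilde Y),$$ the maximum being over all distributions of $X$ on $\{0,1\}^N$. **Lemma.** The limit above exists and is finite, and for every integer $n\ge 1$ $$C_{d,\mathrm{AWGN}}\ \ge\ 1-p_d-H_b(p_d)+\frac1n\sum_{j=1}^n W_j(n)\binom nj p_d^{\,j}(1-p_d)^{n-j}-(1-p_d)\,\mathbb E\!\left[\log\!\left(1+e^{-2z/\sigma^2}\right)\right],\qquad z\sim\mathcal N(1,\sigma^2),$$ where $H_b(p)=-p\log p-(1-p)\log(1-p)$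 and $$W_j(n)=\frac{1}{\binom nj}\sum_{l=1}^{n-1}2^{-l-1}(n-l+3)\sum_{j'=1}^{j}\binom{l}{j'}\binom{n-l}{j-j'}\log\binom{l}{j'}+2^{-n+1}\log\binom nj$$ (terms with $\binom{l}{j'}=0$ are zero). The inequality also holds, in a weaker form, with $z\sim\mathcal N(0,\sigma^2)$ in the expectation. -/

import Mathlib

open MeasureTheory ProbabilityTheory InformationTheory Filter Topology
open scoped ENNReal NNReal

noncomputable section

namespace DelAWGN

/-- BPSK modulation of a bit: `x ↦ 1 - 2 x`, so `0 ↦ 1` and `1 ↦ -1`. -/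
def bpsk (b : Bool) : ℝ := if b then -1 else 1

/-- Finite real sequences of arbitrary length (the possible channel outputs), as the disjoint union
of the spaces `ℝ^k` with its usual measurable structure. -/
abbrev RealWord : Type := Σ k : ℕ, (Fin k → ℝ)

/-- The probability that, among `N` transmitted bits, exactly those with positions in `S` survive,
when every bit is deleted independently with probability `p`. -/
def survivalProb (p : ℝ) {N : ℕ} (S : Finset (Fin N)) : ℝ :=
  ∏ i, if i ∈ S then 1 - p else p

/-- The word that is left of `x` when exactly the bits with positions in `S` survive; the surviving
bits keep their order. -/
def subword {N : ℕ} (x : Fin N → Bool) (S : Finset (Fin N)) : Fin S.card → Bool :=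
  fun i => x (S.orderEmbOfFin rfl i)

/-- The law of the output of the BPSK-input additive white Gaussian noise channel with noise
variance `σ ^ 2` for the input word `w`: the `i`-th output is `bpsk (w i) + z i`, with independent
centred Gaussian `z i` of variance `σ ^ 2`. -/
def awgnLaw (σ : ℝ) {k : ℕ} (w : Fin k → Bool) : Measure RealWord :=
  (Measure.pi fun i => gaussianReal (bpsk (w i)) (σ ^ 2).toNNReal).map
    fun y => (⟨k, y⟩ : RealWord)

/-- The law of the output of the deletion channel followed by the AWGN channel, for the input block
`x`. The positions of the deletions are not part of the output. -/
def outputLaw (p σ : ℝ) {N : ℕ} (x : Fin N → Bool) : Measure RealWord :=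
  ∑ S : Finset (Fin N), ENNReal.ofReal (survivalProb p S) • awgnLaw σ (subword x S)

/-- The deletion-AWGN channel for blocks of `N` bits, as a transition kernel. -/
def channel (p σ : ℝ) (N : ℕ) : Kernel (Fin N → Bool) RealWord :=
  Kernel.ofFunOfCountable fun x => outputLaw p σ x

theorem measurable_mk (k : ℕ) : Measurable fun y : Fin k → ℝ => (⟨k, y⟩ : RealWord) :=
  measurable_iff_le_map.2 (iInf_le _ k)

instance (σ : ℝ) {k : ℕ} (w : Fin k → Bool) : IsProbabilityMeasure (awgnLaw σ w) :=
  Measure.isProbabilityMeasure_map (measurable_mk k).aemeasurable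

theorem sum_survivalProb (p : ℝ) (N : ℕ) : ∑ S : Finset (Fin N), survivalProb p S = 1 := by
  have h := Finset.prod_add (fun _ : Fin N => 1 - p) (fun _ => p) Finset.univ
  simp only [sub_add_cancel, Finset.prod_const_one, Finset.powerset_univ] at h
  rw [h]
  refine Finset.sum_congr rfl fun S _ => ?_
  simp [survivalProb, Finset.prod_ite, Finset.filter_notMem_eq_sdiff]

theorem isMarkovKernel_channel {p : ℝ} (hp₀ : 0 ≤ p) (hp₁ : p ≤ 1) (σ : ℝ) (N : ℕ) :
    IsMarkovKernel (channel p σ N) := by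
  refine ⟨fun x => ⟨?_⟩⟩
  change outputLaw p σ x Set.univ = 1
  simp only [outputLaw, Measure.coe_finsetSum, Finset.sum_apply, Measure.smul_apply, measure_univ,
    smul_eq_mul, mul_one]
  rw [← ENNReal.ofReal_sum_of_nonneg, sum_survivalProb, ENNReal.ofReal_one]
  intro S _
  refine Finset.prod_nonneg fun i _ => ?_
  split_ifs <;> linarith

/-- The mutual information, in bits, between the two coordinates of a pair with joint law `ρ`: the
Kullback-Leibler divergence of `ρ` from the product of its marginals. -/
def mutualInfo {α β : Type*} [MeasurableSpace α] [MeasurableSpace β] (ρ : Measure (α × β)) : ℝ≥0∞ :=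
  klDiv ρ (ρ.fst.prod ρ.snd) / ENNReal.ofReal (Real.log 2)

/-- The largest mutual information between a random block of `N` input bits and the resulting
output, over all laws `P` of the block. -/
def maxMutualInfo (p σ : ℝ) (N : ℕ) : ℝ≥0∞ :=
  ⨆ P : ProbabilityMeasure (Fin N → Bool),
    mutualInfo ((P : Measure (Fin N → Bool)) ⊗ₘ channel p σ N)

/-- The capacity of the deletion-AWGN channel, in bits per transmitted bit: the limit of
`max I(X; Y) / N` as the block length `N` tends to infinity. -/
def capacity (p σ : ℝ) : ℝ≥0∞ :=
  limUnder atTop fun N : ℕ => maxMutualInfo p σ N / (N : ℝ≥0∞)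

/-- The binary entropy function, in bits. -/
def Hb (p : ℝ) : ℝ := -p * Real.logb 2 p - (1 - p) * Real.logb 2 (1 - p)

/-- The coefficients `W_j(n)`. -/
def W (j n : ℕ) : ℝ :=
  1 / (n.choose j : ℝ) *
      ∑ l ∈ Finset.Icc 1 (n - 1), 2 ^ (-(l : ℤ) - 1) * ((n : ℝ) - l + 3) *
        ∑ j' ∈ Finset.Icc 1 j,
          (l.choose j' : ℝ) * ((n - l).choose (j - j') : ℝ) * Real.logb 2 (l.choose j' : ℝ)
    + 2 ^ (-(n : ℤ) + 1) * Real.logb 2 (n.choose j : ℝ)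

/-- The expectation of `log₂ (1 + exp (-2 z / σ ^ 2))` for a Gaussian `z` with mean `m` and variance
`σ ^ 2`. -/
def gaussianLogMean (m σ : ℝ) : ℝ :=
  ∫ z, Real.logb 2 (1 + Real.exp (-2 * z / σ ^ 2)) ∂gaussianReal m (σ ^ 2).toNNReal

/-- The expression
`1 - p - H_b(p) + (1/n) ∑_j W_j(n) C(n,j) p^j (1-p)^(n-j) - (1-p) E[log₂ (1 + exp (-2 z / σ ^ 2))]`
for a Gaussian `z` with mean `m` and variance `σ ^ 2`. -/
def lowerBound (m p σ : ℝ) (n : ℕ) : ℝ :=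
  1 - p - Hb p
    + 1 / (n : ℝ) * ∑ j ∈ Finset.Icc 1 n, W j n * (n.choose j : ℝ) * p ^ j * (1 - p) ^ (n - j)
    - (1 - p) * gaussianLogMean m σ

end DelAWGN

end

/-! Mutual information is the input average of the divergence of `outputLaw` from the output
mixture, and the mixture minimises that average over reference laws (`lintegral_klDiv_eq_add`).
Cutting a block in two makes its output the concatenation of independent outputs. With the image of
a product of mixtures as reference, data processing makes `maxMutualInfo` subadditive, and Fekete's
lemma gives the limit.

For the lower bound take uniform input, with output law `Q`. For fixed `x` the output law is a
mixture, over survival sets `S`, of the Gaussian laws `A_S` with weights `w(S)`. The compensation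
identity writes its divergence from `Q` as the mean of `D(A_S ‖ Q)` minus the mean of `D(A_S ‖
outputLaw)`.

The first term is at least `S.card * symbolDiv` (`card_mul_symbolDiv_le_klDiv`), where `symbolDiv`
is the information per symbol of the AWGN channel without deletions. The second is at most `-log
(w(S) * m)`, because all `m = multiplicity x S` patterns leaving the same word give the same law
`A_S` with the same weight. On average `-log w(S)` gives `N` times the binary entropy, and `log m`
gives back `meanLogMultiplicity`.

That gain is superadditive in the block length, so a bound for length `n` carries over to length `k
* n`. For one block, survivors may be moved freely inside each maximal run, so `m` is at least a
product of binomial coefficients over the runs. Averaging with the expected number of maximal runs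
of each length produces the coefficients `W`. Letting `k → ∞` finishes the proof. -/

/-! ### Chain rules and bounds for the Kullback-Leibler divergence. -/

section KullbackLeibler

variable {α β : Type*} [MeasurableSpace α] [MeasurableSpace β]

/-- The divergence of two composition-products with the same countable first marginal is the
average of the divergences of the fibres. -/
theorem klDiv_compProd_eq_lintegral [Countable α] [MeasurableSingletonClass α]
    (P : Measure α) [IsFiniteMeasure P] (κ η : Kernel α β) [IsMarkovKernel κ] [IsMarkovKernel η] :
    klDiv (P ⊗ₘ κ) (P ⊗ₘ η) = ∫⁻ x, klDiv (κ x) (η x) ∂P := by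
  by_cases hac : P ⊗ₘ κ ≪ P ⊗ₘ η
  · have hfib := Measure.absolutelyContinuous_compProd_right_iff.1 hac
    let f : α → β → ℝ≥0∞ := fun x => (κ x).rnDeriv (η x)
    have hf : Measurable (Function.uncurry f) :=
      measurable_from_prod_countable_right fun x => Measure.measurable_rnDeriv (κ x) (η x)
    have hd : P ⊗ₘ κ = (P ⊗ₘ η).withDensity (Function.uncurry f) := by
      ext s hs
      rw [withDensity_apply _ hs, ← lintegral_indicator hs,
        Measure.lintegral_compProd (hf.indicator hs), Measure.compProd_apply hs]
      refine lintegral_congr_ae ?_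
      filter_upwards [hfib] with x hx
      rw [← Measure.setLIntegral_rnDeriv hx, ← lintegral_indicator (measurable_prodMk_left hs)]
      rfl
    rw [klDiv_eq_lintegral_klFun_of_ac hac]
    have hr : (P ⊗ₘ κ).rnDeriv (P ⊗ₘ η) =ᵐ[P ⊗ₘ η] Function.uncurry f := by
      rw [hd]
      exact Measure.rnDeriv_withDensity _ hf
    rw [lintegral_congr_ae (g := fun p => ENNReal.ofReal (klFun (Function.uncurry f p).toReal))
      (hr.mono fun p hp => by simp only [hp]), Measure.lintegral_compProd (by fun_prop)]
    refine lintegral_congr_ae ?_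
    filter_upwards [hfib] with x hx
    rw [klDiv_eq_lintegral_klFun_of_ac hx]
    rfl
  · rw [klDiv_of_not_ac hac]
    rw [Measure.absolutelyContinuous_compProd_right_iff] at hac
    symm
    refine lintegral_eq_top_of_measure_eq_top_ne_zero (measurable_of_countable _).aemeasurable ?_
    intro h0
    refine hac ((measure_eq_zero_iff_ae_notMem.1 h0).mono fun x hx => ?_)
    by_contra hn
    exact hx (klDiv_of_not_ac hn)

/-- Kullback-Leibler divergence is invariant under measurable equivalences. -/
theorem klDiv_map_measurableEquiv (e : α ≃ᵐ β) (μ ν : Measure α) [IsFiniteMeasure μ]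
    [IsFiniteMeasure ν] : klDiv (μ.map e) (ν.map e) = klDiv μ ν := by
  refine le_antisymm (klDiv_map_le μ ν e.measurable) ?_
  have h := klDiv_map_le (μ.map e) (ν.map e) e.symm.measurable
  rwa [Measure.map_map e.symm.measurable e.measurable,
    Measure.map_map e.symm.measurable e.measurable, e.symm_comp_self, Measure.map_id,
    Measure.map_id] at h

/-- Compensation identity: the mean divergence of the fibres `κ x` from `Q` exceeds their mean
divergence from the mixture of the fibres by the divergence of the mixture from `Q`. -/
theorem lintegral_klDiv_eq_add [Nonempty α] [Countable α] [MeasurableSingletonClass α]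
    (P : Measure α) [IsProbabilityMeasure P] (κ : Kernel α β) [IsMarkovKernel κ]
    (Q : Measure β) [IsProbabilityMeasure Q] :
    ∫⁻ x, klDiv (κ x) Q ∂P = ∫⁻ x, klDiv (κ x) (κ ∘ₘ P) ∂P + klDiv (κ ∘ₘ P) Q := by
  -- Swapping the coordinates puts the output first, so that the chain rule splits off the
  -- divergence of the output marginals and leaves a term independent of `R`.
  have key (R : Measure β) [IsProbabilityMeasure R] :
      ∫⁻ x, klDiv (κ x) R ∂P = klDiv ((P ⊗ₘ κ).map Prod.swap) (R ⊗ₘ Kernel.const β P) := by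
    have h := klDiv_compProd_eq_lintegral P κ (Kernel.const α R)
    simp only [Kernel.const_apply] at h
    rw [← h, Measure.compProd_const, Measure.compProd_const, ← Measure.prod_swap (μ := P)]
    exact (klDiv_map_measurableEquiv (MeasurableEquiv.prodComm (α := α) (β := β)) (P ⊗ₘ κ)
      (P.prod R)).symm
  have hfst : ((P ⊗ₘ κ).map Prod.swap).fst = κ ∘ₘ P := by
    rw [Measure.fst_map_swap, Measure.snd_compProd]
  have hdis := Measure.disintegrate ((P ⊗ₘ κ).map Prod.swap)
    ((P ⊗ₘ κ).map Prod.swap).condKernel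
  rw [hfst] at hdis
  rw [key Q, key (κ ∘ₘ P), ← hdis, klDiv_compProd_eq_add, add_comm]

/-- Bounds mutual information from above through any convenient reference law `Q`. -/
theorem lintegral_klDiv_comp_le [Nonempty α] [Countable α] [MeasurableSingletonClass α]
    (P : Measure α) [IsProbabilityMeasure P] (κ : Kernel α β) [IsMarkovKernel κ]
    (Q : Measure β) [IsProbabilityMeasure Q] :
    ∫⁻ x, klDiv (κ x) (κ ∘ₘ P) ∂P ≤ ∫⁻ x, klDiv (κ x) Q ∂P :=
  (lintegral_klDiv_eq_add P κ Q).symm ▸ le_self_add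

/-- If `a • μ ≤ ν` for probability measures `μ`, `ν`, then the divergence of `μ` from `ν` is at
most `-log a`. -/
theorem klDiv_le_neg_log {μ ν : Measure α} [IsProbabilityMeasure μ] [IsProbabilityMeasure ν]
    {a : ℝ} (ha : 0 < a) (h : ENNReal.ofReal a • μ ≤ ν) :
    klDiv μ ν ≤ ENNReal.ofReal (-Real.log a) := by
  have ha0 : ENNReal.ofReal a ≠ 0 := by simpa using ha
  have hac : μ ≪ ν := fun s hs => by
    have := le_antisymm ((h s).trans hs.le) bot_le
    simpa [ha0] using this
  have hr : ∀ᵐ x ∂ν, (μ.rnDeriv ν x).toReal ≤ a⁻¹ := by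
    filter_upwards [Measure.rnDeriv_le_one_of_le h,
      Measure.rnDeriv_smul_left_of_ne_top μ ν (r := ENNReal.ofReal a) ENNReal.ofReal_ne_top]
      with x hx hx'
    rw [hx', Pi.smul_apply, smul_eq_mul] at hx
    have := ENNReal.toReal_mono ENNReal.one_ne_top hx
    rw [ENNReal.toReal_mul, ENNReal.toReal_ofReal ha.le] at this
    rw [← one_div, le_div_iff₀' ha]
    simpa using this
  have hint : Integrable (fun x => (μ.rnDeriv ν x).toReal * -Real.log a
      + (1 - (μ.rnDeriv ν x).toReal)) ν :=
    (Measure.integrable_toReal_rnDeriv.mul_const _).add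
      ((integrable_const _).sub Measure.integrable_toReal_rnDeriv)
  -- Only the logarithm is estimated. The remainder `1 - dμ/dν` has integral zero, so no constant is
  -- lost.
  have hle : ∀ᵐ x ∂ν, klFun (μ.rnDeriv ν x).toReal ≤ (μ.rnDeriv ν x).toReal * -Real.log a
      + (1 - (μ.rnDeriv ν x).toReal) := by
    filter_upwards [hr] with x hx
    rw [klFun, add_sub_assoc]
    gcongr 1
    have h0 : 0 ≤ (μ.rnDeriv ν x).toReal := ENNReal.toReal_nonneg
    rcases h0.eq_or_lt with h0 | h0
    · simp [← h0]
    · rw [← Real.log_inv]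
      exact mul_le_mul_of_nonneg_left (Real.log_le_log h0 hx) h0.le
  rw [klDiv_eq_lintegral_klFun_of_ac hac]
  refine (lintegral_mono_ae (hle.mono fun x hx => ENNReal.ofReal_le_ofReal hx)).trans ?_
  rw [← ofReal_integral_eq_lintegral_ofReal hint
    (hle.mono fun x hx => (klFun_nonneg ENNReal.toReal_nonneg).trans hx)]
  refine ENNReal.ofReal_le_ofReal (le_of_eq ?_)
  rw [integral_add (f := fun x => (μ.rnDeriv ν x).toReal * -Real.log a)
      (g := fun x => 1 - (μ.rnDeriv ν x).toReal) (Measure.integrable_toReal_rnDeriv.mul_const _)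
      ((integrable_const _).sub Measure.integrable_toReal_rnDeriv), integral_mul_const,
    integral_sub (integrable_const _) Measure.integrable_toReal_rnDeriv,
    Measure.integral_toReal_rnDeriv hac]
  simp

/-- Additivity of the Kullback-Leibler divergence for product measures. -/
theorem klDiv_prod (μ₁ μ₂ : Measure α) (ν₁ ν₂ : Measure β) [IsProbabilityMeasure μ₁]
    [IsProbabilityMeasure μ₂] [IsProbabilityMeasure ν₁] [IsProbabilityMeasure ν₂] :
    klDiv (μ₁.prod ν₁) (μ₂.prod ν₂) = klDiv μ₁ μ₂ + klDiv ν₁ ν₂ := by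
  rw [← Measure.compProd_const, ← Measure.compProd_const, klDiv_compProd_eq_add,
    Measure.compProd_const, Measure.compProd_const, ← Measure.prod_swap (μ := ν₁),
    ← Measure.prod_swap (μ := ν₂), ← klDiv_compProd_left ν₁ ν₂ (Kernel.const β μ₁),
    Measure.compProd_const, Measure.compProd_const]
  congr 1
  exact klDiv_map_measurableEquiv (MeasurableEquiv.prodComm (α := β) (β := α)) _ _

theorem klDiv_pi {k : ℕ} (μ ν : Fin k → Measure α) [∀ i, IsProbabilityMeasure (μ i)]
    [∀ i, IsProbabilityMeasure (ν i)] :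
    klDiv (Measure.pi μ) (Measure.pi ν) = ∑ i, klDiv (μ i) (ν i) := by
  induction k with
  | zero =>
    rw [Subsingleton.elim μ ν]
    simp
  | succ k ih =>
    rw [← klDiv_map_measurableEquiv (MeasurableEquiv.piFinSuccAbove (fun _ => α) 0),
      (measurePreserving_piFinSuccAbove μ 0).map_eq, (measurePreserving_piFinSuccAbove ν 0).map_eq,
      klDiv_prod, ih, Fin.sum_univ_succ]
    rfl

end KullbackLeibler

namespace DelAWGN

/-! ### Survival patterns, surviving words and their multiplicities. -/

section Words

variable {N a b : ℕ}

/-- The surviving word of `x` as a list. -/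
def word (x : Fin N → Bool) (S : Finset (Fin N)) : List Bool := List.ofFn (subword x S)

theorem length_word (x : Fin N → Bool) (S : Finset (Fin N)) : (word x S).length = S.card := by
  simp [word]

/-- Filtering a list commutes with cutting it, which makes concatenation and runs accessible. -/
theorem word_eq_map_filter (x : Fin N → Bool) (S : Finset (Fin N)) :
    word x S = ((List.finRange N).filter (· ∈ S)).map x := by
  have hsort : S.sort = (List.finRange N).filter (· ∈ S) := by
    refine List.Perm.eq_of_pairwise (le := (· ≤ ·)) (fun _ _ _ _ => le_antisymm)
      (S.pairwise_sort _) ?_ ?_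
    · exact ((List.sortedLT_finRange N).pairwise.imp le_of_lt).filter _
    · refine (List.perm_ext_iff_of_nodup (S.sort_nodup _)
        ((List.nodup_finRange N).filter _)).2 fun i => ?_
      simp
  rw [← hsort, word]
  refine List.ext_getElem (by simp) fun i h₁ h₂ => ?_
  simp [subword, Finset.orderEmbOfFin_apply]

/-- Sets of positions of a block of `a + b` bits, as pairs of sets of positions of its two parts. -/
def joinSet : Finset (Fin a) × Finset (Fin b) ≃ Finset (Fin (a + b)) :=
  Finset.sumEquiv.symm.toEquiv.trans finSumFinEquiv.finsetCongr

@[simp] theorem castAdd_mem_joinSet (S : Finset (Fin a) × Finset (Fin b)) (i : Fin a) :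
    Fin.castAdd b i ∈ joinSet S ↔ i ∈ S.1 := by
  simp [joinSet, Finset.sumEquiv]

@[simp] theorem natAdd_mem_joinSet (S : Finset (Fin a) × Finset (Fin b)) (i : Fin b) :
    Fin.natAdd a i ∈ joinSet S ↔ i ∈ S.2 := by
  simp [joinSet, Finset.sumEquiv]

theorem finRange_add (a b : ℕ) : List.finRange (a + b) =
    (List.finRange a).map (Fin.castAdd b) ++ (List.finRange b).map (Fin.natAdd a) := by
  rw [← List.ofFn_eq_map, ← List.ofFn_eq_map, ← List.ofFn_id, ← List.ofFn_fin_append]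
  congr 1
  funext i
  refine Fin.addCases (fun i => ?_) (fun i => ?_) i <;> simp

theorem word_append (x : Fin a → Bool) (y : Fin b → Bool) (S : Finset (Fin a) × Finset (Fin b)) :
    word (Fin.append x y) (joinSet S) = word x S.1 ++ word y S.2 := by
  simp only [word_eq_map_filter, finRange_add, List.filter_append, List.map_append,
    List.filter_map, List.map_map]
  congr 1
  · congr 1
    · funext i; simp
    · congr 1; funext i; simp
  · congr 1
    · funext i; simp
    · congr 1; funext i; simp

theorem survivalProb_joinSet (p : ℝ) (S : Finset (Fin a) × Finset (Fin b)) :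
    survivalProb p (joinSet S) = survivalProb p S.1 * survivalProb p S.2 := by
  simp [survivalProb, Fin.prod_univ_add]

theorem survivalProb_nonneg {p : ℝ} (hp₀ : 0 ≤ p) (hp₁ : p ≤ 1) (S : Finset (Fin N)) :
    0 ≤ survivalProb p S :=
  Finset.prod_nonneg fun i _ => by split_ifs <;> linarith

theorem survivalProb_eq_pow (p : ℝ) (S : Finset (Fin N)) :
    survivalProb p S = (1 - p) ^ S.card * p ^ (N - S.card) := by
  have : (Finset.univ.filter fun i => i ∉ S) = Sᶜ := by ext; simp
  simp [survivalProb, Finset.prod_ite, this, Finset.card_compl]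

theorem log_survivalProb {p : ℝ} {S : Finset (Fin N)} (h : survivalProb p S ≠ 0) :
    Real.log (survivalProb p S) =
      S.card * Real.log (1 - p) + ((N : ℝ) - S.card) * Real.log p := by
  rw [survivalProb_eq_pow] at h ⊢
  rw [Real.log_mul (left_ne_zero_of_mul h) (right_ne_zero_of_mul h), Real.log_pow, Real.log_pow,
    Nat.cast_sub (by simpa using S.card_le_univ)]

/-- The expected number of surviving bits. -/
theorem sum_survivalProb_mul_card (p : ℝ) (N : ℕ) :
    ∑ S : Finset (Fin N), survivalProb p S * S.card = N * (1 - p) := by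
  have hmem (i₀ : Fin N) : ∑ S : Finset (Fin N), survivalProb p S * (if i₀ ∈ S then 1 else 0)
      = 1 - p := by
    -- Setting the deletion weight at `i₀` to zero kills exactly the patterns in which `i₀` is
    -- deleted.
    have h := Finset.prod_add (fun _ : Fin N => 1 - p) (fun i => if i = i₀ then 0 else p) Finset.univ
    rw [Finset.prod_eq_single i₀ (fun i _ hi => by simp [hi]) (by simp)] at h
    simp only [if_true, add_zero, Finset.powerset_univ] at h
    rw [h]
    refine Finset.sum_congr rfl fun S _ => ?_
    have hc : (Finset.univ.filter fun i => i ∉ S) = Finset.univ \ S := by ext; simp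
    split_ifs with hi
    · rw [survivalProb, Finset.prod_ite, mul_one, hc]
      congr 1
      · simp
      · refine Finset.prod_congr rfl fun i hiS => ?_
        rw [if_neg]
        rintro rfl
        simp [hi] at hiS
    · rw [mul_zero, eq_comm]
      refine mul_eq_zero_of_right _ (Finset.prod_eq_zero (i := i₀) (by simpa using hi) (by simp))
  have hcard (S : Finset (Fin N)) : (S.card : ℝ) = ∑ i, if i ∈ S then 1 else 0 := by simp
  simp_rw [hcard, Finset.mul_sum]
  rw [Finset.sum_comm, Finset.sum_congr rfl fun i _ => hmem i]
  simp only [Finset.sum_const, Finset.card_univ, Fintype.card_fin, nsmul_eq_mul]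

/-- The number of ways in which the surviving word of `x` on `S` arises from `x`. -/
def multiplicity (x : Fin N → Bool) (S : Finset (Fin N)) : ℕ :=
  (Finset.univ.filter fun T => word x T = word x S).card

theorem multiplicity_pos (x : Fin N → Bool) (S : Finset (Fin N)) : 0 < multiplicity x S :=
  Finset.card_pos.2 ⟨S, by simp⟩

/-- Explanations of the two halves combine to one of the whole. Equality can fail, since the whole
word does not show where it was cut. -/
theorem multiplicity_mul_le (x : Fin a → Bool) (y : Fin b → Bool)
    (S : Finset (Fin a) × Finset (Fin b)) :
    multiplicity x S.1 * multiplicity y S.2 ≤ multiplicity (Fin.append x y) (joinSet S) := by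
  rw [multiplicity, multiplicity, multiplicity, ← Finset.card_product]
  refine Finset.card_le_card_of_injOn joinSet (fun T hT => ?_) joinSet.injective.injOn
  simp only [Finset.coe_product, Finset.coe_filter, Finset.mem_univ, true_and, Set.mem_prod,
    Set.mem_ofPred_eq] at hT ⊢
  rw [word_append, word_append, hT.1, hT.2]

end Words

/-! ### Measurability and concatenation of real words. -/

section RealWords

theorem measurableEmbedding_mk (k : ℕ) :
    MeasurableEmbedding fun y : Fin k → ℝ => (⟨k, y⟩ : RealWord) := by
  have hinj : Function.Injective fun y : Fin k → ℝ => (⟨k, y⟩ : RealWord) := fun y z h => by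
    simpa using h
  refine ⟨hinj, measurable_mk k, fun s hs => ?_⟩
  refine (MeasurableSpace.measurableSet_iInf).2 fun j => ?_
  change MeasurableSet ((fun y : Fin j → ℝ => (⟨j, y⟩ : RealWord)) ⁻¹' _)
  by_cases h : k = j
  · subst h
    rwa [Set.preimage_image_eq _ hinj]
  · convert MeasurableSet.empty
    ext y
    simp only [Set.mem_preimage, Set.mem_image, Set.mem_empty_iff_false, iff_false, not_exists,
      not_and]
    exact fun z _ hz => h (congrArg Sigma.fst hz)

theorem measurable_of_comp_mk {γ : Type*} [MeasurableSpace γ] {f : RealWord → γ}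
    (hf : ∀ k, Measurable fun y : Fin k → ℝ => f ⟨k, y⟩) : Measurable f :=
  fun _ hs => (MeasurableSpace.measurableSet_iInf).2 fun k => hf k hs

/-- The product is a countable union of measurably embedded pieces, one for each pair of lengths. -/
theorem measurable_of_comp_mk_prod {γ : Type*} [MeasurableSpace γ] {f : RealWord × RealWord → γ}
    (hf : ∀ j k, Measurable fun y : (Fin j → ℝ) × (Fin k → ℝ) => f (⟨j, y.1⟩, ⟨k, y.2⟩)) :
    Measurable f := by
  intro s hs
  have : f ⁻¹' s = ⋃ j, ⋃ k, Prod.map (fun y : Fin j → ℝ => (⟨j, y⟩ : RealWord))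
      (fun y : Fin k → ℝ => (⟨k, y⟩ : RealWord)) ''
      ((fun y : (Fin j → ℝ) × (Fin k → ℝ) => f (⟨j, y.1⟩, ⟨k, y.2⟩)) ⁻¹' s) := by
    ext ⟨⟨j, u⟩, ⟨k, v⟩⟩
    simp only [Set.mem_preimage, Set.mem_iUnion, Set.mem_image]
    constructor
    · exact fun h => ⟨j, k, (u, v), h, rfl⟩
    · rintro ⟨j', k', y, hy, he⟩
      rw [← he]
      exact hy
  rw [this]
  exact MeasurableSet.iUnion fun j => MeasurableSet.iUnion fun k =>
    ((measurableEmbedding_mk j).prodMap (measurableEmbedding_mk k)).measurableSet_image.2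
      (hf j k hs)

/-- Concatenation of real words. -/
def cat (u : RealWord × RealWord) : RealWord := ⟨u.1.1 + u.2.1, Fin.append u.1.2 u.2.2⟩

theorem measurable_append (j k : ℕ) :
    Measurable fun y : (Fin j → ℝ) × (Fin k → ℝ) => Fin.append y.1 y.2 := by
  refine measurable_pi_lambda _ fun i => ?_
  refine Fin.addCases (fun i => ?_) (fun i => ?_) i
  · simp only [Fin.append_left]; fun_prop
  · simp only [Fin.append_right]; fun_prop

theorem measurable_cat : Measurable cat :=
  measurable_of_comp_mk_prod fun j k => (measurable_mk (j + k)).comp (measurable_append j k)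

theorem map_append_prod_pi {j k : ℕ} (μ : Fin j → Measure ℝ) (ν : Fin k → Measure ℝ)
    [∀ i, IsProbabilityMeasure (μ i)] [∀ i, IsProbabilityMeasure (ν i)]
    (ρ : Fin (j + k) → Measure ℝ) [∀ i, SigmaFinite (ρ i)]
    (hμ : ∀ i, ρ (Fin.castAdd k i) = μ i) (hν : ∀ i, ρ (Fin.natAdd j i) = ν i) :
    ((Measure.pi μ).prod (Measure.pi ν)).map (fun y => Fin.append y.1 y.2) = Measure.pi ρ := by
  symm
  refine Measure.pi_eq fun s hs => ?_
  rw [Measure.map_apply (measurable_append j k) (.univ_pi hs)]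
  have : (fun y : (Fin j → ℝ) × (Fin k → ℝ) => Fin.append y.1 y.2) ⁻¹' (Set.univ.pi s) =
      (Set.univ.pi fun i => s (Fin.castAdd k i)) ×ˢ (Set.univ.pi fun i => s (Fin.natAdd j i)) := by
    ext y
    simp only [Set.mem_preimage, Set.mem_pi, Set.mem_univ, true_imp_iff, Set.mem_prod]
    constructor
    · intro h
      exact ⟨fun i => by simpa using h (Fin.castAdd k i), fun i => by simpa using h (Fin.natAdd j i)⟩
    · intro h i
      refine Fin.addCases (fun i => ?_) (fun i => ?_) i
      · simpa using h.1 i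
      · simpa using h.2 i
  rw [this, Measure.prod_prod, Measure.pi_pi, Measure.pi_pi, Fin.prod_univ_add]
  simp [hμ, hν]

theorem map_cat_awgnLaw (σ : ℝ) {j k : ℕ} (u : Fin j → Bool) (v : Fin k → Bool) :
    ((awgnLaw σ u).prod (awgnLaw σ v)).map cat = awgnLaw σ (Fin.append u v) := by
  rw [awgnLaw, awgnLaw, Measure.map_prod_map _ _ (measurable_mk j) (measurable_mk k),
    Measure.map_map measurable_cat ((measurable_mk j).prodMap (measurable_mk k)), awgnLaw,
    ← map_append_prod_pi (fun i => gaussianReal (bpsk (u i)) (σ ^ 2).toNNReal)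
      (fun i => gaussianReal (bpsk (v i)) (σ ^ 2).toNNReal) _ (by simp) (by simp),
    Measure.map_map (measurable_mk _) (measurable_append j k)]
  rfl

/-- Comparing words as lists avoids casts between lengths that are only propositionally equal. -/
theorem awgnLaw_congr (σ : ℝ) {j k : ℕ} {u : Fin j → Bool} {v : Fin k → Bool}
    (h : List.ofFn u = List.ofFn v) : awgnLaw σ u = awgnLaw σ v := by
  have := List.ofFn_inj'.1 h
  cases this
  rfl

end RealWords

/-! ### The output law as a mixture over survival patterns. -/

section OutputLaw

variable {a b N : ℕ}

theorem lintegral_outputLaw (p σ : ℝ) (x : Fin N → Bool) (f : RealWord → ℝ≥0∞) :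
    ∫⁻ y, f y ∂outputLaw p σ x =
      ∑ S, ENNReal.ofReal (survivalProb p S) * ∫⁻ y, f y ∂awgnLaw σ (subword x S) := by
  simp [outputLaw, lintegral_finsetSum_measure, lintegral_smul_measure]

theorem isProbabilityMeasure_outputLaw {p : ℝ} (hp₀ : 0 ≤ p) (hp₁ : p ≤ 1) (σ : ℝ)
    (x : Fin N → Bool) : IsProbabilityMeasure (outputLaw p σ x) :=
  (isMarkovKernel_channel hp₀ hp₁ σ N).isProbabilityMeasure x

theorem outputLaw_append {p : ℝ} (hp₀ : 0 ≤ p) (hp₁ : p ≤ 1) (σ : ℝ) (x : Fin a → Bool)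
    (y : Fin b → Bool) :
    outputLaw p σ (Fin.append x y) = ((outputLaw p σ x).prod (outputLaw p σ y)).map cat := by
  have := isProbabilityMeasure_outputLaw hp₀ hp₁ σ x
  have := isProbabilityMeasure_outputLaw hp₀ hp₁ σ y
  refine Measure.ext_of_lintegral _ fun f hf => ?_
  have hfc : Measurable fun z => f (cat z) := hf.comp measurable_cat
  rw [lintegral_map hf measurable_cat, lintegral_prod _ hfc.aemeasurable, lintegral_outputLaw,
    lintegral_outputLaw, ← joinSet.sum_comp, Fintype.sum_prod_type]
  refine Finset.sum_congr rfl fun S _ => ?_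
  have hin (u : RealWord) : ∫⁻ v, f (cat (u, v)) ∂outputLaw p σ y = ∑ T,
      ENNReal.ofReal (survivalProb p T) * ∫⁻ v, f (cat (u, v)) ∂awgnLaw σ (subword y T) :=
    lintegral_outputLaw p σ y _
  simp_rw [hin]
  rw [lintegral_finsetSum _ fun T _ => (hfc.lintegral_prod_right').const_mul _, Finset.mul_sum]
  refine Finset.sum_congr rfl fun T _ => ?_
  rw [lintegral_const_mul _ hfc.lintegral_prod_right', ← mul_assoc,
    ← ENNReal.ofReal_mul (survivalProb_nonneg hp₀ hp₁ S), survivalProb_joinSet,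
    ← lintegral_prod (fun z => f (cat z)) hfc.aemeasurable, ← lintegral_map hf measurable_cat,
    map_cat_awgnLaw]
  congr 2
  refine awgnLaw_congr σ ?_
  rw [List.ofFn_fin_append]
  exact word_append x y (S, T)

/-- Patterns leaving the same word have the same number of survivors, hence equal weight and equal
Gaussian law. Their terms alone add up to the left side. -/
theorem smul_awgnLaw_le_outputLaw (p σ : ℝ) (x : Fin N → Bool)
    (S : Finset (Fin N)) :
    ENNReal.ofReal (survivalProb p S * multiplicity x S) • awgnLaw σ (subword x S) ≤
      outputLaw p σ x := by
  have hcard (T : Finset (Fin N)) (hT : word x T = word x S) :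
      survivalProb p T = survivalProb p S := by
    rw [survivalProb_eq_pow, survivalProb_eq_pow, ← length_word x T, hT, length_word]
  intro s
  simp only [outputLaw, Measure.coe_finsetSum, Finset.sum_apply, Measure.smul_apply, smul_eq_mul]
  refine le_trans (le_of_eq ?_) (Finset.sum_le_sum_of_subset (Finset.subset_univ
    (Finset.univ.filter fun T => word x T = word x S)))
  rw [Finset.sum_congr rfl (g := fun _ => ENNReal.ofReal (survivalProb p S) *
    awgnLaw σ (subword x S) s)]
  · rw [Finset.sum_const, nsmul_eq_mul, ← mul_assoc, mul_comm (survivalProb p S),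
      ENNReal.ofReal_mul (by positivity), ENNReal.ofReal_natCast, multiplicity]
  · intro T hT
    have hT := (Finset.mem_filter.1 hT).2
    rw [hcard T hT, awgnLaw_congr σ hT]

end OutputLaw

/-! ### Subadditivity of the maximal information and existence of the limit. -/

section Capacity

variable {p : ℝ}

theorem mutualInfo_compProd {α β : Type*} [MeasurableSpace α] [MeasurableSpace β] [Countable α]
    [MeasurableSingletonClass α] (P : Measure α) [IsProbabilityMeasure P] (κ : Kernel α β)
    [IsMarkovKernel κ] :
    mutualInfo (P ⊗ₘ κ) = (∫⁻ x, klDiv (κ x) (κ ∘ₘ P) ∂P) / ENNReal.ofReal (Real.log 2) := by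
  rw [mutualInfo, Measure.fst_compProd, Measure.snd_compProd, ← Measure.compProd_const,
    klDiv_compProd_eq_lintegral]
  rfl

/-- The uniform law on blocks of `N` bits. -/
noncomputable def uniformBits (N : ℕ) : Measure (Fin N → Bool) :=
  (PMF.uniformOfFintype (Fin N → Bool)).toMeasure

instance (N : ℕ) : IsProbabilityMeasure (uniformBits N) :=
  inferInstanceAs (IsProbabilityMeasure (PMF.toMeasure _))

theorem lintegral_uniformBits {N : ℕ} (f : (Fin N → Bool) → ℝ≥0∞) :
    ∫⁻ x, f x ∂uniformBits N = ENNReal.ofReal ((2 ^ N)⁻¹) * ∑ x, f x := by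
  have h (x : Fin N → Bool) : uniformBits N {x} = ENNReal.ofReal ((2 ^ N)⁻¹) := by
    rw [uniformBits, PMF.toMeasure_apply_singleton _ _ (measurableSet_singleton x),
      ENNReal.ofReal_inv_of_pos (by positivity), ENNReal.ofReal_pow (by norm_num)]
    simp
  rw [lintegral_fintype, Finset.mul_sum]
  exact Finset.sum_congr rfl fun x _ => by rw [h, mul_comm]

/-- The law of the output for a uniformly distributed input block. -/
noncomputable def uniformOutput (p σ : ℝ) (N : ℕ) : Measure RealWord :=
  channel p σ N ∘ₘ uniformBits N

theorem lintegral_uniformOutput (p σ : ℝ) (N : ℕ) {f : RealWord → ℝ≥0∞} (hf : Measurable f) :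
    ∫⁻ y, f y ∂uniformOutput p σ N =
      ENNReal.ofReal ((2 ^ N)⁻¹) * ∑ x : Fin N → Bool, ∫⁻ y, f y ∂outputLaw p σ x := by
  rw [uniformOutput, Measure.lintegral_bind (channel p σ N).aemeasurable hf.aemeasurable,
    lintegral_uniformBits]
  rfl

theorem isProbabilityMeasure_uniformOutput (hp₀ : 0 ≤ p) (hp₁ : p ≤ 1) (σ : ℝ) (N : ℕ) :
    IsProbabilityMeasure (uniformOutput p σ N) :=
  have := isMarkovKernel_channel hp₀ hp₁ σ N
  inferInstanceAs (IsProbabilityMeasure (channel p σ N ∘ₘ uniformBits N))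

theorem smul_outputLaw_le_uniformOutput (p σ : ℝ) {N : ℕ} (x : Fin N → Bool) :
    ENNReal.ofReal ((2 ^ N)⁻¹) • outputLaw p σ x ≤ uniformOutput p σ N := by
  refine Measure.le_iff.2 fun s hs => ?_
  rw [← lintegral_indicator_one (μ := uniformOutput p σ N) hs,
    lintegral_uniformOutput _ _ _ (measurable_one.indicator hs),
    Measure.smul_apply, smul_eq_mul]
  gcongr
  rw [← lintegral_indicator_one hs]
  exact Finset.single_le_sum (f := fun x => ∫⁻ y, s.indicator 1 y ∂outputLaw p σ x)
    (fun _ _ => bot_le) (Finset.mem_univ x)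

theorem ofReal_log_two_ne_zero : ENNReal.ofReal (Real.log 2) ≠ 0 := by
  simpa using Real.log_pos one_lt_two

theorem maxMutualInfo_le_of_forall (hp₀ : 0 ≤ p) (hp₁ : p ≤ 1) (σ : ℝ) {N : ℕ} {B : ℝ≥0∞}
    (h : ∀ P : Measure (Fin N → Bool), IsProbabilityMeasure P →
      ∫⁻ x, klDiv (outputLaw p σ x) (channel p σ N ∘ₘ P) ∂P ≤ B * ENNReal.ofReal (Real.log 2)) :
    maxMutualInfo p σ N ≤ B := by
  have := isMarkovKernel_channel hp₀ hp₁ σ N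
  refine iSup_le fun P => ?_
  rw [mutualInfo_compProd]
  exact ENNReal.div_le_of_le_mul (h P inferInstance)

theorem lintegral_klDiv_le_maxMutualInfo (hp₀ : 0 ≤ p) (hp₁ : p ≤ 1) (σ : ℝ) {N : ℕ}
    (P : Measure (Fin N → Bool)) [hP : IsProbabilityMeasure P] :
    ∫⁻ x, klDiv (outputLaw p σ x) (channel p σ N ∘ₘ P) ∂P ≤
      maxMutualInfo p σ N * ENNReal.ofReal (Real.log 2) := by
  have := isMarkovKernel_channel hp₀ hp₁ σ N
  have h := le_iSup (fun P : ProbabilityMeasure (Fin N → Bool) =>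
    mutualInfo ((P : Measure (Fin N → Bool)) ⊗ₘ channel p σ N)) ⟨P, hP⟩
  rw [ProbabilityMeasure.coe_mk, mutualInfo_compProd] at h
  exact (ENNReal.div_le_iff ofReal_log_two_ne_zero ENNReal.ofReal_ne_top).1 h

/-- With the uniform-input output as reference, every fibre has divergence at most `N * log 2`,
since it occurs in that mixture with weight `2⁻ᴺ`. -/
theorem maxMutualInfo_le (hp₀ : 0 ≤ p) (hp₁ : p ≤ 1) (σ : ℝ) (N : ℕ) :
    maxMutualInfo p σ N ≤ N := by
  have := isMarkovKernel_channel hp₀ hp₁ σ N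
  have := isProbabilityMeasure_uniformOutput hp₀ hp₁ σ N
  refine maxMutualInfo_le_of_forall hp₀ hp₁ σ fun P hP => ?_
  refine (lintegral_klDiv_comp_le P (channel p σ N) (uniformOutput p σ N)).trans ?_
  refine (lintegral_mono (g := fun _ => (N : ℝ≥0∞) * ENNReal.ofReal (Real.log 2)) fun x => ?_).trans
    (by simp)
  have := isProbabilityMeasure_outputLaw hp₀ hp₁ σ x
  refine (klDiv_le_neg_log (by positivity) (smul_outputLaw_le_uniformOutput p σ x)).trans
    (le_of_eq ?_)
  rw [Real.log_inv, neg_neg, Real.log_pow, ENNReal.ofReal_mul (by positivity),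
    ENNReal.ofReal_natCast]

/-- Revealing the cut between the two outputs can only help, and the two halves then use independent
channels. The reference is the concatenation of independent outputs for the two input marginals. -/
theorem maxMutualInfo_add_le (hp₀ : 0 ≤ p) (hp₁ : p ≤ 1) (σ : ℝ) (a b : ℕ) :
    maxMutualInfo p σ (a + b) ≤ maxMutualInfo p σ a + maxMutualInfo p σ b := by
  have := isMarkovKernel_channel hp₀ hp₁ σ a
  have := isMarkovKernel_channel hp₀ hp₁ σ b
  have := isMarkovKernel_channel hp₀ hp₁ σ (a + b)
  refine maxMutualInfo_le_of_forall hp₀ hp₁ σ fun P hP => ?_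
  let f₁ : (Fin (a + b) → Bool) → Fin a → Bool := fun x i => x (Fin.castAdd b i)
  let f₂ : (Fin (a + b) → Bool) → Fin b → Bool := fun x i => x (Fin.natAdd a i)
  have hf₁ : Measurable f₁ := measurable_of_countable _
  have hf₂ : Measurable f₂ := measurable_of_countable _
  have := Measure.isProbabilityMeasure_map (μ := P) hf₁.aemeasurable
  have := Measure.isProbabilityMeasure_map (μ := P) hf₂.aemeasurable
  let Q₁ := channel p σ a ∘ₘ P.map f₁
  let Q₂ := channel p σ b ∘ₘ P.map f₂
  have := Measure.isProbabilityMeasure_map (μ := Q₁.prod Q₂) measurable_cat.aemeasurable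
  refine (lintegral_klDiv_comp_le P (channel p σ (a + b)) ((Q₁.prod Q₂).map cat)).trans ?_
  have hle (x : Fin (a + b) → Bool) :
      klDiv (channel p σ (a + b) x) ((Q₁.prod Q₂).map cat) ≤
        klDiv (outputLaw p σ (f₁ x)) Q₁ + klDiv (outputLaw p σ (f₂ x)) Q₂ := by
    have := isProbabilityMeasure_outputLaw hp₀ hp₁ σ (f₁ x)
    have := isProbabilityMeasure_outputLaw hp₀ hp₁ σ (f₂ x)
    have hx : channel p σ (a + b) x =
        ((outputLaw p σ (f₁ x)).prod (outputLaw p σ (f₂ x))).map cat := by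
      rw [← outputLaw_append hp₀ hp₁, Fin.append_castAdd_natAdd]
      rfl
    rw [hx, ← klDiv_prod]
    exact klDiv_map_le _ _ measurable_cat
  refine (lintegral_mono hle).trans ?_
  rw [lintegral_add_left (measurable_of_countable _), add_mul]
  refine add_le_add ?_ ?_
  · rw [← lintegral_map (f := fun y => klDiv (outputLaw p σ y) Q₁) (measurable_of_countable _) hf₁]
    exact lintegral_klDiv_le_maxMutualInfo hp₀ hp₁ σ _
  · rw [← lintegral_map (f := fun y => klDiv (outputLaw p σ y) Q₂) (measurable_of_countable _) hf₂]
    exact lintegral_klDiv_le_maxMutualInfo hp₀ hp₁ σ _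

theorem maxMutualInfo_ne_top (hp₀ : 0 ≤ p) (hp₁ : p ≤ 1) (σ : ℝ) (N : ℕ) :
    maxMutualInfo p σ N ≠ ∞ :=
  ne_top_of_le_ne_top (ENNReal.natCast_ne_top N) (maxMutualInfo_le hp₀ hp₁ σ N)

/-- The mutual information rate converges, and its limit is the capacity. -/
theorem exists_tendsto_maxMutualInfo_div (hp₀ : 0 ≤ p) (hp₁ : p ≤ 1) (σ : ℝ) :
    ∃ L : ℝ, 0 ≤ L ∧ capacity p σ = ENNReal.ofReal L ∧
      Tendsto (fun N : ℕ => (maxMutualInfo p σ N).toReal / N) atTop (𝓝 L) ∧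
      Tendsto (fun N : ℕ => maxMutualInfo p σ N / (N : ℝ≥0∞)) atTop (𝓝 (capacity p σ)) := by
  have hsub : Subadditive fun N => (maxMutualInfo p σ N).toReal := fun a b => by
    rw [← ENNReal.toReal_add (maxMutualInfo_ne_top hp₀ hp₁ σ a) (maxMutualInfo_ne_top hp₀ hp₁ σ b)]
    exact ENNReal.toReal_mono (ENNReal.add_ne_top.2 ⟨maxMutualInfo_ne_top hp₀ hp₁ σ a,
      maxMutualInfo_ne_top hp₀ hp₁ σ b⟩) (maxMutualInfo_add_le hp₀ hp₁ σ a b)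
  have hlim := hsub.tendsto_lim ⟨0, by rintro _ ⟨N, rfl⟩; positivity⟩
  have h0 : 0 ≤ hsub.lim := ge_of_tendsto' hlim fun N => by positivity
  have hE : Tendsto (fun N : ℕ => maxMutualInfo p σ N / (N : ℝ≥0∞)) atTop
      (𝓝 (ENNReal.ofReal hsub.lim)) := by
    refine ((ENNReal.continuous_ofReal.tendsto _).comp hlim).congr' ?_
    filter_upwards [eventually_gt_atTop 0] with N hN
    rw [Function.comp_apply, ENNReal.ofReal_div_of_pos (by exact_mod_cast hN),
      ENNReal.ofReal_toReal (maxMutualInfo_ne_top hp₀ hp₁ σ N), ENNReal.ofReal_natCast]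
  -- Convergence is known here, so `limUnder` is the true limit and not a default value.
  have hc : capacity p σ = ENNReal.ofReal hsub.lim := hE.limUnder_eq
  exact ⟨hsub.lim, h0, hc, hlim, hc ▸ hE⟩

end Capacity

/-! ### The information of a single BPSK symbol. -/

section Gaussian

variable {σ : ℝ}

/-- The output law of the BPSK-input AWGN channel for a uniformly distributed input bit. -/
noncomputable def mixLaw (σ : ℝ) : Measure ℝ :=
  (2⁻¹ : ℝ≥0∞) • (gaussianReal 1 (σ ^ 2).toNNReal + gaussianReal (-1) (σ ^ 2).toNNReal)

instance (σ : ℝ) : IsProbabilityMeasure (mixLaw σ) := ⟨by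
  simp only [mixLaw, Measure.smul_apply, Measure.add_apply, measure_univ, smul_eq_mul]
  rw [one_add_one_eq_two, ENNReal.inv_mul_cancel two_ne_zero ENNReal.ofNat_ne_top]⟩

theorem mixLaw_apply (σ : ℝ) (s : Set ℝ) :
    mixLaw σ s = 2⁻¹ * ∑ b, gaussianReal (bpsk b) (σ ^ 2).toNNReal s := by
  simp [mixLaw, bpsk, add_comm, mul_add]

/-- The divergence of the law of one received symbol from the law for a uniform input bit. -/
noncomputable def symbolDiv (σ : ℝ) : ℝ≥0∞ :=
  klDiv (gaussianReal 1 (σ ^ 2).toNNReal) (mixLaw σ)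

/-- The reflection `z ↦ -z` exchanges the two Gaussians and fixes `mixLaw`. -/
theorem klDiv_gaussianReal_bpsk (σ : ℝ) (b : Bool) :
    klDiv (gaussianReal (bpsk b) (σ ^ 2).toNNReal) (mixLaw σ) = symbolDiv σ := by
  cases b
  · simp [bpsk, symbolDiv]
  · have h := klDiv_map_measurableEquiv (MeasurableEquiv.neg ℝ)
      (gaussianReal 1 (σ ^ 2).toNNReal) (mixLaw σ)
    have hmap (m : ℝ) : (gaussianReal m (σ ^ 2).toNNReal).map (MeasurableEquiv.neg ℝ) =
        gaussianReal (-m) (σ ^ 2).toNNReal := gaussianReal_map_neg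
    rw [symbolDiv, ← h, mixLaw, Measure.map_smul, Measure.map_add _ _ (MeasurableEquiv.measurable _),
      hmap, hmap, neg_neg, add_comm]
    simp [bpsk]

theorem symbolDiv_ne_top (σ : ℝ) : symbolDiv σ ≠ ∞ := by
  refine ne_top_of_le_ne_top ENNReal.ofReal_ne_top
    (klDiv_le_neg_log (a := 2⁻¹) (by norm_num) fun s => ?_)
  rw [ENNReal.ofReal_inv_of_pos two_pos, ENNReal.ofReal_ofNat]
  simp only [mixLaw, Measure.smul_apply, smul_eq_mul, Measure.add_apply]
  gcongr
  exact le_self_add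

theorem log_one_add_exp_le (t : ℝ) : Real.log (1 + Real.exp t) ≤ Real.log 2 + |t| := by
  rw [← Real.log_exp |t|, ← Real.log_mul two_ne_zero (Real.exp_pos _).ne']
  refine Real.log_le_log (by positivity) ?_
  have h₁ := Real.exp_le_exp.2 (le_abs_self t)
  have h₂ := Real.one_le_exp (abs_nonneg t)
  linarith

theorem log_one_add_exp_nonneg (t : ℝ) : 0 ≤ Real.log (1 + Real.exp t) :=
  Real.log_nonneg (by linarith [Real.exp_pos t])

theorem integrable_log_one_add_exp (m : ℝ) (v : ℝ≥0) (c : ℝ) :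
    Integrable (fun z => Real.log (1 + Real.exp (c * z))) (gaussianReal m v) := by
  have hid : Integrable (fun z : ℝ => z) (gaussianReal m v) :=
    (memLp_id_gaussianReal (μ := m) (v := v) 1).integrable (by norm_num)
  refine Integrable.mono' ((integrable_const (Real.log 2)).add (hid.const_mul c).abs)
    (Measurable.aestronglyMeasurable (by fun_prop)) (ae_of_all _ fun z => ?_)
  rw [Real.norm_of_nonneg (log_one_add_exp_nonneg _)]
  exact log_one_add_exp_le _

theorem gaussianLogMean_eq (m σ : ℝ) : gaussianLogMean m σ =
    (∫ z, Real.log (1 + Real.exp (-2 / σ ^ 2 * z)) ∂gaussianReal m (σ ^ 2).toNNReal) /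
      Real.log 2 := by
  rw [gaussianLogMean, ← integral_div]
  refine integral_congr_ae (ae_of_all _ fun z => ?_)
  simp only [Real.logb]
  rw [div_mul_eq_mul_div]

/-- Translate the centred Gaussian by one; the integrand is nonincreasing in `z`. -/
theorem gaussianLogMean_one_le_zero (σ : ℝ) : gaussianLogMean 1 σ ≤ gaussianLogMean 0 σ := by
  have hmap : gaussianReal 1 (σ ^ 2).toNNReal = (gaussianReal 0 (σ ^ 2).toNNReal).map (· + 1) := by
    rw [gaussianReal_map_add_const, zero_add]
  rw [gaussianLogMean_eq, gaussianLogMean_eq]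
  refine div_le_div_of_nonneg_right ?_ (Real.log_nonneg one_le_two)
  have hi := integrable_log_one_add_exp 1 (σ ^ 2).toNNReal (-2 / σ ^ 2)
  rw [hmap] at hi ⊢
  rw [integrable_map_measure hi.1 (by fun_prop)] at hi
  rw [integral_map (by fun_prop) (Measurable.aestronglyMeasurable (by fun_prop))]
  refine integral_mono hi (integrable_log_one_add_exp 0 _ _) fun z => ?_
  refine Real.log_le_log (by positivity) ?_
  gcongr 1 + Real.exp ?_
  have : -2 / σ ^ 2 ≤ 0 := div_nonpos_of_nonpos_of_nonneg (by norm_num) (sq_nonneg σ)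
  nlinarith

theorem gaussianReal_one_eq_withDensity (hσ : 0 < σ) :
    gaussianReal 1 (σ ^ 2).toNNReal = (mixLaw σ).withDensity
      fun z => ENNReal.ofReal (2 / (1 + Real.exp (-2 / σ ^ 2 * z))) := by
  have hv : (σ ^ 2).toNNReal ≠ 0 := by simpa using hσ.ne'
  have hmix : mixLaw σ = volume.withDensity fun z => ENNReal.ofReal
      (2⁻¹ * (gaussianPDFReal 1 (σ ^ 2).toNNReal z + gaussianPDFReal (-1) (σ ^ 2).toNNReal z)) := by
    rw [mixLaw, gaussianReal_of_var_ne_zero _ hv, gaussianReal_of_var_ne_zero _ hv,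
      ← withDensity_add_left (measurable_gaussianPDF _ _),
      ← withDensity_smul _ ((measurable_gaussianPDF _ _).add (measurable_gaussianPDF _ _))]
    congr 1
    funext z
    rw [ENNReal.ofReal_mul (by norm_num), ENNReal.ofReal_add (gaussianPDFReal_nonneg _ _ _)
      (gaussianPDFReal_nonneg _ _ _), ENNReal.ofReal_inv_of_pos two_pos, ENNReal.ofReal_ofNat]
    rfl
  have hm (m : ℝ) := measurable_gaussianPDFReal m (σ ^ 2).toNNReal
  have h₁ := hm 1
  have h₂ := hm (-1)
  rw [hmix, ← withDensity_mul _ (by fun_prop) (by fun_prop), gaussianReal_of_var_ne_zero _ hv]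
  congr 1
  funext z
  rw [Pi.mul_apply, ← ENNReal.ofReal_mul (mul_nonneg (by norm_num) (add_nonneg
    (gaussianPDFReal_nonneg _ _ _) (gaussianPDFReal_nonneg _ _ _))), gaussianPDF]
  congr 1
  -- The likelihood ratio of the two symbols: the squares `(z + 1) ^ 2` and `(z - 1) ^ 2` differ by
  -- `4 * z`.
  have hr : gaussianPDFReal (-1) (σ ^ 2).toNNReal z =
      gaussianPDFReal 1 (σ ^ 2).toNNReal z * Real.exp (-2 / σ ^ 2 * z) := by
    rw [gaussianPDFReal, gaussianPDFReal, mul_assoc (√_)⁻¹, ← Real.exp_add,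
      Real.coe_toNNReal _ (sq_nonneg σ)]
    congr 2
    field_simp
    ring
  have hpos : (1 + Real.exp (-2 / σ ^ 2 * z)) ≠ 0 := by positivity
  rw [hr]
  field_simp

theorem toReal_symbolDiv (hσ : 0 < σ) :
    (symbolDiv σ).toReal = Real.log 2 * (1 - gaussianLogMean 1 σ) := by
  have hd := gaussianReal_one_eq_withDensity hσ
  have hac : gaussianReal 1 (σ ^ 2).toNNReal ≪ mixLaw σ :=
    hd ▸ withDensity_absolutelyContinuous _ _
  have hllr : llr (gaussianReal 1 (σ ^ 2).toNNReal) (mixLaw σ) =ᵐ[gaussianReal 1 (σ ^ 2).toNNReal]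
      fun z => Real.log 2 - Real.log (1 + Real.exp (-2 / σ ^ 2 * z)) := by
    have hr := Measure.rnDeriv_withDensity (mixLaw σ)
      (f := fun z => ENNReal.ofReal (2 / (1 + Real.exp (-2 / σ ^ 2 * z)))) (by fun_prop)
    rw [← hd] at hr
    filter_upwards [hac.ae_le hr] with z hz
    rw [llr, hz, ENNReal.toReal_ofReal (by positivity),
      Real.log_div two_ne_zero (by positivity)]
  rw [symbolDiv, toReal_klDiv_of_measure_eq hac (by simp), integral_congr_ae hllr,
    integral_sub (integrable_const _) (integrable_log_one_add_exp _ _ _), gaussianLogMean_eq]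
  have := Real.log_pos one_lt_two
  simp
  field_simp

end Gaussian

/-! ### The output for uniform input, read at a fixed length. -/

section UniformOutput

variable {p : ℝ} {N k : ℕ}

/-- Averaging product measures over the uniform choice of the labels of the factors. -/
theorem sum_pi_comp_injective (G : Bool → Measure ℝ) [∀ b, IsProbabilityMeasure (G b)]
    (η : Measure ℝ) [IsProbabilityMeasure η] (hη : ∀ s, η s = 2⁻¹ * ∑ b, G b s)
    {e : Fin k → Fin N} (he : Function.Injective e) :
    (ENNReal.ofReal ((2 ^ N)⁻¹) • ∑ x : Fin N → Bool, Measure.pi fun i => G (x (e i))) =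
      Measure.pi fun _ => η := by
  symm
  refine Measure.pi_eq fun s _ => ?_
  simp only [Measure.smul_apply, Measure.coe_finsetSum, Finset.sum_apply, Measure.pi_pi,
    smul_eq_mul]
  -- Factors are grouped by input bit. A bit outside the range of `e` gives an empty product, whose
  -- sum over both values cancels its factor `2⁻¹`.
  let g : Fin N → Bool → ℝ≥0∞ := fun j b => ∏ i with e i = j, G b (s i)
  have hx (x : Fin N → Bool) : ∏ i, G (x (e i)) (s i) = ∏ j, g j (x j) := by
    rw [← Finset.prod_fiberwise (g := e)]
    refine Finset.prod_congr rfl fun j _ => Finset.prod_congr rfl fun i hi => ?_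
    rw [(Finset.mem_filter.1 hi).2]
  have hsum : ∑ x : Fin N → Bool, ∏ j, g j (x j) = ∏ j, ∑ b, g j b := by
    rw [Finset.prod_univ_sum, Fintype.piFinset_univ]
  have hpow : ENNReal.ofReal ((2 ^ N)⁻¹) = ∏ _j : Fin N, (2⁻¹ : ℝ≥0∞) := by
    rw [ENNReal.ofReal_inv_of_pos (by positivity), ENNReal.ofReal_pow (by norm_num)]
    simp [ENNReal.inv_pow]
  rw [Finset.sum_congr rfl fun x _ => hx x, hsum, hpow, ← Finset.prod_mul_distrib]
  symm
  refine Fintype.prod_of_injective e he _ _ (fun j hj => ?_) (fun i => ?_)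
  · have : (Finset.univ.filter fun i => e i = j) = ∅ :=
      Finset.filter_eq_empty_iff.2 fun i _ h => hj ⟨i, h⟩
    simp only [g, this, Finset.prod_empty, Finset.sum_const, Finset.card_univ, Fintype.card_bool]
    simp [ENNReal.inv_mul_cancel]
  · have : (Finset.univ.filter fun i' => e i' = e i) = {i} := by
      ext i'; simp [he.eq_iff]
    simp [g, this, hη]

open Classical in
/-- The kernel that reads off a real word of length `k` and replaces all other words by an
independent block with law `η`. -/
noncomputable def readKernel (k : ℕ) (η : Measure (Fin k → ℝ)) : Kernel RealWord (Fin k → ℝ) where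
  toFun u := if h : u.1 = k then Measure.dirac (fun i => u.2 (i.cast h.symm)) else η
  measurable' := by
    refine measurable_of_comp_mk fun j => ?_
    by_cases h : j = k
    · subst h
      simp only [dite_true]
      exact Measure.measurable_dirac
    · simp only [h, dite_false]
      exact measurable_const

instance (η : Measure (Fin k → ℝ)) [IsProbabilityMeasure η] :
    IsMarkovKernel (readKernel k η) := ⟨fun u => by
  change IsProbabilityMeasure (dite _ _ _)
  split_ifs <;> infer_instance⟩

theorem readKernel_comp_awgnLaw (σ : ℝ) (η : Measure (Fin k → ℝ)) (w : Fin k → Bool) :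
    readKernel k η ∘ₘ awgnLaw σ w =
      Measure.pi fun i => gaussianReal (bpsk (w i)) (σ ^ 2).toNNReal := by
  ext s hs
  rw [Measure.bind_apply hs (readKernel k η).aemeasurable, awgnLaw,
    lintegral_map ((readKernel k η).measurable_coe hs) (measurable_mk k)]
  simp only [readKernel, Kernel.coe_mk, dite_true, Fin.cast_refl, id]
  simp_rw [Measure.dirac_apply' _ hs]
  exact lintegral_indicator_one hs

theorem readKernel_comp_awgnLaw_of_ne (σ : ℝ) (η : Measure (Fin k → ℝ)) {j : ℕ} (w : Fin j → Bool)
    (h : j ≠ k) : readKernel k η ∘ₘ awgnLaw σ w = η := by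
  ext s hs
  rw [Measure.bind_apply hs (readKernel k η).aemeasurable, awgnLaw,
    lintegral_map ((readKernel k η).measurable_coe hs) (measurable_mk j)]
  simp [readKernel, h]

/-- Every survival pattern contributes the same law: with `k` survivors, averaging over the input
makes the symbols i.i.d. with law `mixLaw`; otherwise the kernel supplies this law itself. -/
theorem readKernel_comp_uniformOutput (hp₀ : 0 ≤ p) (hp₁ : p ≤ 1) (σ : ℝ) (N k : ℕ) :
    readKernel k (Measure.pi fun _ => mixLaw σ) ∘ₘ uniformOutput p σ N =
      Measure.pi fun _ => mixLaw σ := by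
  set η := Measure.pi fun _ : Fin k => mixLaw σ
  ext s hs
  have hread {μ : Measure RealWord} : ∫⁻ y, readKernel k η y s ∂μ = (readKernel k η ∘ₘ μ) s :=
    (Measure.bind_apply hs (readKernel k η).aemeasurable).symm
  rw [← hread, lintegral_uniformOutput _ _ _ ((readKernel k η).measurable_coe hs)]
  simp_rw [lintegral_outputLaw, hread]
  rw [Finset.sum_comm, Finset.mul_sum]
  have hS (S : Finset (Fin N)) : ENNReal.ofReal ((2 ^ N)⁻¹) * ∑ x : Fin N → Bool,
      ENNReal.ofReal (survivalProb p S) * (readKernel k η ∘ₘ awgnLaw σ (subword x S)) s =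
      ENNReal.ofReal (survivalProb p S) * η s := by
    rw [← Finset.mul_sum, mul_left_comm]
    congr 1
    by_cases h : S.card = k
    · subst h
      simp_rw [readKernel_comp_awgnLaw]
      have := sum_pi_comp_injective (fun b => gaussianReal (bpsk b) (σ ^ 2).toNNReal) (mixLaw σ)
        (mixLaw_apply σ) (S.orderEmbOfFin rfl).injective
      have := congrArg (fun μ : Measure _ => μ s) this
      simp only [Measure.smul_apply, Measure.coe_finsetSum, Finset.sum_apply, smul_eq_mul] at this
      exact this
    · simp_rw [readKernel_comp_awgnLaw_of_ne σ η _ h]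
      rw [Finset.sum_const, nsmul_eq_mul, ← mul_assoc, ENNReal.ofReal_inv_of_pos (by positivity),
        ENNReal.ofReal_pow (by norm_num)]
      simp only [ENNReal.ofReal_ofNat, Finset.card_univ, Fintype.card_pi, Fintype.card_bool,
        Finset.prod_const, Fintype.card_fin, Nat.cast_pow, Nat.cast_ofNat]
      rw [ENNReal.inv_mul_cancel (by simp) (by simp), one_mul]
  rw [Finset.sum_congr rfl fun S _ => hS S, ← Finset.sum_mul,
    ← ENNReal.ofReal_sum_of_nonneg fun S _ => survivalProb_nonneg hp₀ hp₁ S, sum_survivalProb,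
    ENNReal.ofReal_one, one_mul]

/-- Data processing through `readKernel` leaves two product measures, whose divergence is a sum over
symbols. -/
theorem card_mul_symbolDiv_le_klDiv (hp₀ : 0 ≤ p) (hp₁ : p ≤ 1) (σ : ℝ) (N : ℕ)
    (w : Fin k → Bool) : k * symbolDiv σ ≤ klDiv (awgnLaw σ w) (uniformOutput p σ N) := by
  have := isProbabilityMeasure_uniformOutput hp₀ hp₁ σ N
  have h := klDiv_comp_right_le (μ := awgnLaw σ w) (ν := uniformOutput p σ N)
    (readKernel k (Measure.pi fun _ => mixLaw σ))
  rw [readKernel_comp_awgnLaw, readKernel_comp_uniformOutput hp₀ hp₁, klDiv_pi] at h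
  simpa [klDiv_gaussianReal_bpsk] using h

end UniformOutput

/-! ### Finite mixtures. -/

section Mixture

variable {ι β : Type*} [Fintype ι] [Nonempty ι] [MeasurableSpace β]

/-- Compensation identity for finite mixtures. -/
theorem sum_mul_klDiv_eq_add (c : ι → ℝ≥0∞) (hc : ∑ i, c i = 1) (μ : ι → Measure β)
    [∀ i, IsProbabilityMeasure (μ i)] (Q : Measure β) [IsProbabilityMeasure Q] :
    ∑ i, c i * klDiv (μ i) Q =
      ∑ i, c i * klDiv (μ i) (∑ j, c j • μ j) + klDiv (∑ j, c j • μ j) Q := by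
  let : MeasurableSpace ι := ⊤
  let P : Measure ι := ∑ i, c i • Measure.dirac i
  have : IsProbabilityMeasure P := ⟨by simp [P, hc]⟩
  let κ : Kernel ι β := Kernel.ofFunOfCountable μ
  have : IsMarkovKernel κ := ⟨fun i => inferInstanceAs (IsProbabilityMeasure (μ i))⟩
  have hP (f : ι → ℝ≥0∞) : ∫⁻ i, f i ∂P = ∑ i, c i * f i := by
    simp [P, lintegral_finsetSum_measure, lintegral_smul_measure]
  have hκ : κ ∘ₘ P = ∑ j, c j • μ j := by
    ext s hs
    rw [Measure.bind_apply hs κ.aemeasurable, hP]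
    simp [Measure.coe_finsetSum, κ, Kernel.ofFunOfCountable]
  have h := lintegral_klDiv_eq_add P κ Q
  rw [hP, hP, hκ] at h
  exact h

end Mixture

/-! ### Information for uniform input and the gain from multiplicities. -/

section InformationBound

variable {p σ : ℝ} {N : ℕ}

theorem survivalProb_mul_multiplicity_le_one (hp₀ : 0 ≤ p) (hp₁ : p ≤ 1) (x : Fin N → Bool)
    (S : Finset (Fin N)) : survivalProb p S * multiplicity x S ≤ 1 := by
  have := isProbabilityMeasure_outputLaw hp₀ hp₁ 1 x
  have h := smul_awgnLaw_le_outputLaw p 1 x S Set.univ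
  simpa using h

theorem sum_survivalProb_mul_log (p : ℝ) (x : Fin N → Bool) :
    ∑ S, survivalProb p S * -Real.log (survivalProb p S * multiplicity x S) =
      -(N * ((1 - p) * Real.log (1 - p) + p * Real.log p)) -
        ∑ S, survivalProb p S * Real.log (multiplicity x S) := by
  have hterm (S : Finset (Fin N)) :
      survivalProb p S * -Real.log (survivalProb p S * multiplicity x S) =
        -(Real.log (1 - p) - Real.log p) * (survivalProb p S * S.card)
          - N * Real.log p * survivalProb p S
          - survivalProb p S * Real.log (multiplicity x S) := by
    -- Patterns of weight zero, which occur for `p = 0` or `p = 1`, drop out before any logarithm is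
    -- split.
    by_cases h : survivalProb p S = 0
    · simp [h]
    · rw [Real.log_mul h (by exact_mod_cast (multiplicity_pos x S).ne'), log_survivalProb h]
      ring
  rw [Finset.sum_congr rfl fun S _ => hterm S, Finset.sum_sub_distrib, Finset.sum_sub_distrib,
    ← Finset.mul_sum, ← Finset.mul_sum, sum_survivalProb_mul_card, sum_survivalProb]
  ring

theorem klDiv_outputLaw_ne_top (hp₀ : 0 ≤ p) (hp₁ : p ≤ 1) (σ : ℝ) (x : Fin N → Bool) :
    klDiv (outputLaw p σ x) (uniformOutput p σ N) ≠ ∞ := by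
  have := isProbabilityMeasure_outputLaw hp₀ hp₁ σ x
  have := isProbabilityMeasure_uniformOutput hp₀ hp₁ σ N
  exact ne_top_of_le_ne_top ENNReal.ofReal_ne_top
    (klDiv_le_neg_log (by positivity) (smul_outputLaw_le_uniformOutput p σ x))

/-- Lower bound for the divergence of the output law for input `x` from the output law for
uniformly distributed input. -/
theorem le_toReal_klDiv_outputLaw (hp₀ : 0 ≤ p) (hp₁ : p ≤ 1) (σ : ℝ) (x : Fin N → Bool) :
    N * ((1 - p) * (symbolDiv σ).toReal + (1 - p) * Real.log (1 - p) + p * Real.log p) +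
      ∑ S, survivalProb p S * Real.log (multiplicity x S) ≤
        (klDiv (outputLaw p σ x) (uniformOutput p σ N)).toReal := by
  have := isProbabilityMeasure_outputLaw hp₀ hp₁ σ x
  have := isProbabilityMeasure_uniformOutput hp₀ hp₁ σ N
  have hw (S : Finset (Fin N)) := survivalProb_nonneg hp₀ hp₁ S
  have hnn (S : Finset (Fin N)) :
      0 ≤ survivalProb p S * -Real.log (survivalProb p S * multiplicity x S) :=
    mul_nonneg (hw S) (neg_nonneg.2 (Real.log_nonpos (mul_nonneg (hw S) (Nat.cast_nonneg _))
      (survivalProb_mul_multiplicity_le_one hp₀ hp₁ x S)))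
  have hcomp := sum_mul_klDiv_eq_add (fun S : Finset (Fin N) => ENNReal.ofReal (survivalProb p S))
    (by rw [← ENNReal.ofReal_sum_of_nonneg fun S _ => hw S, sum_survivalProb, ENNReal.ofReal_one])
    (fun S => awgnLaw σ (subword x S)) (uniformOutput p σ N)
  -- The compensation identity, with its left side bounded below by symbol divergences and the
  -- divergences from the mixture bounded above by `-log` of the weights. Subtraction waits until
  -- all terms are known to be finite.
  have hle : ∑ S : Finset (Fin N), ENNReal.ofReal (survivalProb p S) * (S.card * symbolDiv σ) ≤
      ENNReal.ofReal (∑ S : Finset (Fin N),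
        survivalProb p S * -Real.log (survivalProb p S * multiplicity x S)) +
      klDiv (outputLaw p σ x) (uniformOutput p σ N) := by
    refine (Finset.sum_le_sum fun S _ => mul_le_mul_right
      (card_mul_symbolDiv_le_klDiv hp₀ hp₁ σ N (subword x S)) _).trans ?_
    rw [hcomp, ← outputLaw, ENNReal.ofReal_sum_of_nonneg fun S _ => hnn S]
    refine add_le_add (Finset.sum_le_sum fun S _ => ?_) le_rfl
    rcases (hw S).eq_or_lt with h0 | h0
    · simp [← h0]
    · rw [ENNReal.ofReal_mul (hw S)]
      gcongr
      exact klDiv_le_neg_log (mul_pos h0 (by exact_mod_cast multiplicity_pos x S))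
        (smul_awgnLaw_le_outputLaw p σ x S)
  have hreal := ENNReal.toReal_mono (ENNReal.add_ne_top.2 ⟨ENNReal.ofReal_ne_top,
    klDiv_outputLaw_ne_top hp₀ hp₁ σ x⟩) hle
  rw [ENNReal.toReal_add ENNReal.ofReal_ne_top (klDiv_outputLaw_ne_top hp₀ hp₁ σ x),
    ENNReal.toReal_ofReal (Finset.sum_nonneg fun S _ => hnn S), sum_survivalProb_mul_log,
    ENNReal.toReal_sum fun S _ => ENNReal.mul_ne_top ENNReal.ofReal_ne_top
      (ENNReal.mul_ne_top (ENNReal.natCast_ne_top _) (symbolDiv_ne_top σ))] at hreal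
  have hsum : ∑ S : Finset (Fin N),
      (ENNReal.ofReal (survivalProb p S) * (S.card * symbolDiv σ)).toReal =
      N * (1 - p) * (symbolDiv σ).toReal := by
    rw [← sum_survivalProb_mul_card, Finset.sum_mul]
    refine Finset.sum_congr rfl fun S _ => ?_
    rw [ENNReal.toReal_mul, ENNReal.toReal_mul, ENNReal.toReal_ofReal (hw S),
      ENNReal.toReal_natCast, mul_assoc]
  rw [hsum] at hreal
  linarith

/-- The mean logarithm of the number of deletion patterns that explain the surviving word, for a
uniformly distributed block of `N` bits. It is the conditional entropy, in nats, of the deletion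
pattern given the block and its surviving word. -/
noncomputable def meanLogMultiplicity (p : ℝ) (N : ℕ) : ℝ :=
  (2 ^ N)⁻¹ * ∑ x : Fin N → Bool, ∑ S, survivalProb p S * Real.log (multiplicity x S)

theorem le_maxMutualInfo (hp₀ : 0 ≤ p) (hp₁ : p ≤ 1) (σ : ℝ) (N : ℕ) :
    N * ((1 - p) * (symbolDiv σ).toReal + (1 - p) * Real.log (1 - p) + p * Real.log p) +
      meanLogMultiplicity p N ≤ (maxMutualInfo p σ N).toReal * Real.log 2 := by
  have hle := lintegral_klDiv_le_maxMutualInfo hp₀ hp₁ σ (uniformBits N)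
  rw [lintegral_uniformBits, ← uniformOutput] at hle
  have hreal := ENNReal.toReal_mono
    (ENNReal.mul_ne_top (maxMutualInfo_ne_top hp₀ hp₁ σ N) ENNReal.ofReal_ne_top) hle
  rw [ENNReal.toReal_mul, ENNReal.toReal_mul, ENNReal.toReal_ofReal (by positivity),
    ENNReal.toReal_ofReal (Real.log_nonneg one_le_two),
    ENNReal.toReal_sum fun x _ => klDiv_outputLaw_ne_top hp₀ hp₁ σ x] at hreal
  refine le_trans ?_ hreal
  refine le_trans (le_of_eq ?_) (mul_le_mul_of_nonneg_left
    (Finset.sum_le_sum fun x _ => le_toReal_klDiv_outputLaw hp₀ hp₁ σ x) (by positivity))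
  rw [Finset.sum_add_distrib, mul_add, meanLogMultiplicity, Finset.sum_const, Finset.card_univ]
  simp only [Fintype.card_pi, Fintype.card_bool, Finset.prod_const, Finset.card_univ,
    Fintype.card_fin, nsmul_eq_mul, Nat.cast_pow, Nat.cast_ofNat]
  field_simp

/-- Inputs and survival weights of the two halves are independent, so `multiplicity_mul_le` can be
averaged after taking logarithms. -/
theorem meanLogMultiplicity_add_le (hp₀ : 0 ≤ p) (hp₁ : p ≤ 1) (a b : ℕ) :
    meanLogMultiplicity p a + meanLogMultiplicity p b ≤ meanLogMultiplicity p (a + b) := by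
  have hterm (x : Fin a → Bool) (y : Fin b → Bool) :
      ∑ S, survivalProb p S * Real.log (multiplicity x S) +
        ∑ S, survivalProb p S * Real.log (multiplicity y S) ≤
      ∑ S, survivalProb p S * Real.log (multiplicity (Fin.append x y) S) := by
    have h₁ : ∑ S, survivalProb p S * Real.log (multiplicity x S) = ∑ S : Finset (Fin a),
        ∑ T : Finset (Fin b), survivalProb p S * survivalProb p T *
          Real.log (multiplicity x S) := by
      refine Finset.sum_congr rfl fun S _ => ?_
      rw [← Finset.sum_mul, ← Finset.mul_sum, sum_survivalProb, mul_one]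
    have h₂ : ∑ S, survivalProb p S * Real.log (multiplicity y S) = ∑ S : Finset (Fin a),
        ∑ T : Finset (Fin b), survivalProb p S * survivalProb p T *
          Real.log (multiplicity y T) := by
      simp_rw [mul_assoc, ← Finset.mul_sum]
      rw [← Finset.sum_mul, sum_survivalProb, one_mul]
    rw [h₁, h₂, ← joinSet.sum_comp, Fintype.sum_prod_type, ← Finset.sum_add_distrib]
    refine Finset.sum_le_sum fun S _ => ?_
    rw [← Finset.sum_add_distrib]
    refine Finset.sum_le_sum fun T _ => ?_
    rw [survivalProb_joinSet, ← mul_add]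
    refine mul_le_mul_of_nonneg_left ?_
      (mul_nonneg (survivalProb_nonneg hp₀ hp₁ S) (survivalProb_nonneg hp₀ hp₁ T))
    have hS := multiplicity_pos x S
    have hT := multiplicity_pos y T
    rw [← Real.log_mul (by positivity) (by positivity)]
    refine Real.log_le_log (by positivity) ?_
    exact_mod_cast multiplicity_mul_le x y (S, T)
  have hsum := Finset.sum_le_sum fun x (_ : x ∈ Finset.univ) =>
    Finset.sum_le_sum fun y (_ : y ∈ Finset.univ) => hterm x y
  have happ : ∑ x : Fin a → Bool, ∑ y : Fin b → Bool,
      ∑ S, survivalProb p S * Real.log (multiplicity (Fin.append x y) S) =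
      ∑ z : Fin (a + b) → Bool, ∑ S, survivalProb p S * Real.log (multiplicity z S) := by
    rw [← (Fin.appendEquiv a b).sum_comp, Fintype.sum_prod_type]
    rfl
  rw [happ] at hsum
  have h := mul_le_mul_of_nonneg_left hsum (by positivity : (0 : ℝ) ≤ (2 ^ (a + b))⁻¹)
  refine le_trans (le_of_eq ?_) h
  simp only [Finset.sum_add_distrib, Finset.sum_const, Finset.card_univ, Fintype.card_pi,
    Fintype.card_bool, Finset.prod_const, Fintype.card_fin, nsmul_eq_mul, ← Finset.mul_sum,
    meanLogMultiplicity]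
  push_cast
  rw [pow_add]
  field_simp

theorem mul_meanLogMultiplicity_le (hp₀ : 0 ≤ p) (hp₁ : p ≤ 1) (k n : ℕ) :
    k * meanLogMultiplicity p n ≤ meanLogMultiplicity p (k * n) := by
  induction k with
  | zero =>
    rw [Nat.cast_zero, zero_mul]
    refine mul_nonneg (by positivity) (Finset.sum_nonneg fun x _ => Finset.sum_nonneg fun S _ =>
      mul_nonneg (survivalProb_nonneg hp₀ hp₁ S) (Real.log_natCast_nonneg _))
  | succ k ih =>
    have h := meanLogMultiplicity_add_le hp₀ hp₁ (k * n) n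
    rw [← Nat.succ_mul] at h
    push_cast
    linarith

end InformationBound

/-! ### Maximal runs, and deletion patterns that agree run by run. -/

section Runs

variable {n : ℕ}

/-- The positions `i` of a block of `n` bits with `lo ≤ i < hi`. -/
def interval (n lo hi : ℕ) : Finset (Fin n) := Finset.univ.filter fun i => lo ≤ i.1 ∧ i.1 < hi

@[simp] theorem mem_interval {lo hi : ℕ} {i : Fin n} :
    i ∈ interval n lo hi ↔ lo ≤ i.1 ∧ i.1 < hi := by
  simp [interval]

theorem card_interval {lo hi : ℕ} (h : hi ≤ n) : (interval n lo hi).card = hi - lo := by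
  rw [← Nat.card_Ico, ← Finset.card_map Fin.valEmbedding]
  congr 1
  ext i
  simp only [Finset.mem_map, mem_interval, Fin.valEmbedding_apply, Finset.mem_Ico]
  exact ⟨by rintro ⟨i, hi, rfl⟩; exact hi, fun hi => ⟨⟨i, by omega⟩, hi, rfl⟩⟩

theorem filter_lt_append_filter_not_lt {l : List (Fin n)} (hl : l.Pairwise (· ≤ ·)) (s : ℕ) :
    l = l.filter (fun i => i.1 < s) ++ l.filter (fun i => ¬ i.1 < s) := by
  induction l with
  | nil => rfl
  | cons i l ih =>
    rw [List.pairwise_cons] at hl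
    by_cases hi : i.1 < s
    · simpa [hi] using ih hl.2
    · have h₁ : l.filter (fun i => decide (i.1 < s)) = [] := List.filter_eq_nil_iff.2 fun j hj => by
        have := Fin.le_def.1 (hl.1 j hj)
        simp only [decide_eq_true_eq]
        omega
      have h₂ : l.filter (fun i => decide (¬ i.1 < s)) = l := List.filter_eq_self.2 fun j hj => by
        have := Fin.le_def.1 (hl.1 j hj)
        simp only [decide_eq_true_eq]
        omega
      rw [List.filter_cons_of_neg (by simpa using hi), List.filter_cons_of_pos (by simpa using hi),
        h₁, h₂, List.nil_append]

/-- The surviving word only depends on the number of survivors in an interval on which the input is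
constant. -/
theorem word_congr_interval {x : Fin n → Bool} {S T : Finset (Fin n)} {lo hi : ℕ} {c : Bool}
    (hx : ∀ i ∈ interval n lo hi, x i = c) (hout : ∀ i ∉ interval n lo hi, i ∈ S ↔ i ∈ T)
    (hcard : (S ∩ interval n lo hi).card = (T ∩ interval n lo hi).card) :
    word x S = word x T := by
  have hsplit : List.finRange n = (List.finRange n).filter (fun i => i.1 < lo) ++
      (((List.finRange n).filter (fun i => ¬ i.1 < lo)).filter (fun i => i.1 < hi) ++
        ((List.finRange n).filter (fun i => ¬ i.1 < lo)).filter (fun i => ¬ i.1 < hi)) := by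
    have hp := (List.sortedLT_finRange n).pairwise.imp le_of_lt
    rw [← filter_lt_append_filter_not_lt (hp.filter _) hi]
    exact filter_lt_append_filter_not_lt hp lo
  have hmid (U : Finset (Fin n)) :
      ((((List.finRange n).filter (fun i => ¬ i.1 < lo)).filter (fun i => i.1 < hi)).filter
        (· ∈ U)).map x = List.replicate (U ∩ interval n lo hi).card c := by
    rw [List.eq_replicate_iff]
    constructor
    · rw [List.length_map, ← List.toFinset_card_of_nodup
        ((((List.nodup_finRange n).filter _).filter _).filter _)]
      congr 1
      ext i
      simp [and_comm]
    · intro d hd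
      simp only [List.mem_map, List.mem_filter, decide_eq_true_eq] at hd
      obtain ⟨i, ⟨⟨⟨-, h₁⟩, h₂⟩, -⟩, rfl⟩ := hd
      exact hx i (mem_interval.2 ⟨not_lt.1 h₁, h₂⟩)
  rw [word_eq_map_filter, word_eq_map_filter, hsplit]
  simp only [List.filter_append, List.map_append]
  rw [hmid, hmid, hcard]
  congr 1
  · congr 1
    refine List.filter_congr fun i hi => ?_
    simp only [List.mem_filter, decide_eq_true_eq] at hi
    rw [decide_eq_decide]
    refine hout i fun h => ?_
    have := mem_interval.1 h
    omega
  · congr 2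
    refine List.filter_congr fun i hi => ?_
    simp only [List.mem_filter, decide_eq_true_eq] at hi
    rw [decide_eq_decide]
    refine hout i fun h => ?_
    have := mem_interval.1 h
    omega

/-- The positions of the run that starts at `r.1` and has length `r.2`. -/
def run (n : ℕ) (r : ℕ × ℕ) : Finset (Fin n) := interval n r.1 (r.1 + r.2)

theorem word_congr_runs {x : Fin n → Bool} (R : Finset (ℕ × ℕ))
    (hx : ∀ r ∈ R, ∃ c, ∀ i ∈ run n r, x i = c)
    (hd : (R : Set (ℕ × ℕ)).PairwiseDisjoint (run n)) {S T : Finset (Fin n)}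
    (hout : ∀ i, (∀ r ∈ R, i ∉ run n r) → (i ∈ S ↔ i ∈ T))
    (hcard : ∀ r ∈ R, (S ∩ run n r).card = (T ∩ run n r).card) :
    word x S = word x T := by
  induction R using Finset.induction_on generalizing S with
  | empty =>
    congr 1
    ext i
    exact hout i (by simp)
  | insert r R hr ih =>
    have hdr : ∀ r' ∈ R, Disjoint (run n r) (run n r') := fun r' hr' =>
      hd (by simp) (by simp [hr']) (by rintro rfl; exact hr hr')
    -- A hybrid agreeing with `T` on the run `r` and with `S` elsewhere, so the patterns are
    -- exchanged one run at a time.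
    let S' : Finset (Fin n) := (S \ run n r) ∪ (T ∩ run n r)
    have hS' : S' ∩ run n r = T ∩ run n r := by
      ext i; simp only [S', Finset.mem_inter, Finset.mem_union, Finset.mem_sdiff]; tauto
    obtain ⟨c, hc⟩ := hx r (by simp)
    have h₁ : word x S = word x S' := by
      refine word_congr_interval (lo := r.1) (hi := r.1 + r.2) hc (fun i hi => ?_) ?_
      · have hi : i ∉ run n r := hi
        simp [S', hi]
      · exact (hcard r (by simp)).trans (congrArg Finset.card hS').symm
    rw [h₁]
    refine ih (fun r' hr' => hx r' (by simp [hr'])) (hd.subset (by simp)) (fun i hi => ?_)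
      (fun r' hr' => ?_)
    · by_cases hir : i ∈ run n r
      · simp [S', hir]
      · have := hout i (by simpa using ⟨hir, fun a b h => hi (a, b) h⟩)
        simp [S', hir, this]
    · rw [← hcard r' (by simp [hr'])]
      congr 1
      ext i
      have : i ∈ run n r → i ∉ run n r' := fun h => Finset.disjoint_left.1 (hdr r' hr') h
      simp only [S', Finset.mem_inter, Finset.mem_union, Finset.mem_sdiff]
      tauto

/-- In each run, the survivors can be replaced by any subset of equal size without changing the
word. Disjointness makes the choices independent and recoverable from the pattern. -/
theorem prod_choose_le_multiplicity {x : Fin n → Bool} (R : Finset (ℕ × ℕ))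
    (hx : ∀ r ∈ R, ∃ c, ∀ i ∈ run n r, x i = c)
    (hd : (R : Set (ℕ × ℕ)).PairwiseDisjoint (run n)) (S : Finset (Fin n)) :
    ∏ r ∈ R, (run n r).card.choose (S ∩ run n r).card ≤ multiplicity x S := by
  let A : Finset ((r : R) → Finset (Fin n)) := Fintype.piFinset fun r : R =>
    (run n r.1).powersetCard (S ∩ run n r.1).card
  have hA : A.card = ∏ r ∈ R, (run n r).card.choose (S ∩ run n r).card := by
    rw [Fintype.card_piFinset, ← Finset.prod_coe_sort R]
    exact Finset.prod_congr rfl fun r _ => Finset.card_powersetCard _ _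
  have hmem (f : (r : R) → Finset (Fin n)) (hf : f ∈ A) (r : R) :
      f r ⊆ run n r.1 ∧ (f r).card = (S ∩ run n r.1).card :=
    Finset.mem_powersetCard.1 (Fintype.mem_piFinset.1 hf r)
  let T (f : (r : R) → Finset (Fin n)) : Finset (Fin n) :=
    (S \ R.biUnion (run n)) ∪ Finset.univ.biUnion f
  have hT (f : (r : R) → Finset (Fin n)) (hf : f ∈ A) (r : R) : T f ∩ run n r.1 = f r := by
    ext i
    simp only [T, Finset.mem_inter, Finset.mem_union, Finset.mem_sdiff, Finset.mem_biUnion,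
      Finset.mem_univ, true_and]
    constructor
    · rintro ⟨h | ⟨r', hr'⟩, hir⟩
      · exact absurd ⟨r.1, r.2, hir⟩ h.2
      · have : r' = r := by
          by_contra hne
          exact Finset.disjoint_left.1 (hd r'.2 r.2 fun h => hne (Subtype.ext h))
            ((hmem f hf r').1 hr') hir
        exact this ▸ hr'
    · exact fun h => ⟨Or.inr ⟨r, h⟩, (hmem f hf r).1 h⟩
  rw [← hA, multiplicity]
  refine Finset.card_le_card_of_injOn T (fun f hf => ?_) fun f hf g hg h => ?_
  · simp only [Finset.coe_filter, Finset.mem_univ, true_and, Set.mem_ofPred_eq]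
    refine word_congr_runs R hx hd (fun i hi => ?_) fun r hr => ?_
    · simp only [T, Finset.mem_union, Finset.mem_sdiff, Finset.mem_biUnion, Finset.mem_univ,
        true_and]
      constructor
      · rintro (h | ⟨r, hr⟩)
        · exact h.1
        · exact absurd ((hmem f hf r).1 hr) (hi r.1 r.2)
      · exact fun h => Or.inl ⟨h, fun ⟨r, hr, hir⟩ => hi r hr hir⟩
    · rw [hT f hf ⟨r, hr⟩]
      exact (hmem f hf ⟨r, hr⟩).2
  · funext r
    rw [← hT f hf r, ← hT g hg r, h]

/-- The possible values of the bits of a block for which the run `r` is maximal and carries the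
bit `b`. -/
def runBits (n : ℕ) (r : ℕ × ℕ) (b : Bool) (i : Fin n) : Finset Bool :=
  if i ∈ run n r then {b} else if i.1 + 1 = r.1 ∨ i.1 = r.1 + r.2 then {!b} else Finset.univ

/-- The blocks for which `r` is a maximal run. -/
def runBlocks (n : ℕ) (r : ℕ × ℕ) : Finset (Fin n → Bool) :=
  Finset.univ.biUnion fun b => Fintype.piFinset (runBits n r b)

theorem mem_runBlocks {r : ℕ × ℕ} {x : Fin n → Bool} :
    x ∈ runBlocks n r ↔ ∃ b, (∀ i ∈ run n r, x i = b) ∧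
      ∀ i : Fin n, i.1 + 1 = r.1 ∨ i.1 = r.1 + r.2 → x i = !b := by
  simp only [runBlocks, Finset.mem_biUnion, Finset.mem_univ, true_and, Fintype.mem_piFinset]
  refine exists_congr fun b => ⟨fun h => ⟨fun i hi => ?_, fun i hi => ?_⟩, fun h i => ?_⟩
  · simpa [runBits, hi] using h i
  · have hn : i ∉ run n r := by simp only [run, mem_interval]; omega
    simpa [runBits, hn, hi] using h i
  · rw [runBits]
    split_ifs with h₁ h₂
    · simpa using h.1 i h₁
    · simpa using h.2 i h₂
    · simp

/-- The start positions and lengths of the intervals in a block of `n` bits. -/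
def runIndex (n : ℕ) : Finset (Σ _ : ℕ, ℕ) :=
  (Finset.Icc 1 n).sigma fun l => Finset.range (n - l + 1)

/-- The maximal runs of `x`. -/
def maxRuns (x : Fin n → Bool) : Finset (ℕ × ℕ) :=
  ((runIndex n).image fun r => (r.2, r.1)).filter fun r => x ∈ runBlocks n r

theorem mem_maxRuns {x : Fin n → Bool} {r : ℕ × ℕ} :
    r ∈ maxRuns x ↔ (1 ≤ r.2 ∧ r.1 + r.2 ≤ n) ∧ x ∈ runBlocks n r := by
  simp only [maxRuns, runIndex, Finset.mem_filter, Finset.mem_image, Finset.mem_sigma,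
    Finset.mem_Icc, Finset.mem_range, Sigma.exists]
  refine and_congr_left fun _ => ⟨?_, fun h => ⟨r.2, r.1, ⟨by omega, by omega⟩, rfl⟩⟩
  rintro ⟨l, s, h, rfl⟩
  simp only
  omega

theorem pairwiseDisjoint_maxRuns (x : Fin n → Bool) :
    (maxRuns x : Set (ℕ × ℕ)).PairwiseDisjoint (run n) := by
  have key {r r' : ℕ × ℕ} (hr : r ∈ maxRuns x) (hr' : r' ∈ maxRuns x) {i : Fin n}
      (hi : i ∈ run n r) (hi' : i ∈ run n r') : r'.1 ≤ r.1 ∧ r.1 + r.2 ≤ r'.1 + r'.2 := by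
    obtain ⟨-, hb⟩ := mem_maxRuns.1 hr
    obtain ⟨-, hb'⟩ := mem_maxRuns.1 hr'
    obtain ⟨b, hb₁, hb₂⟩ := mem_runBlocks.1 hb
    obtain ⟨b', hb₁', hb₂'⟩ := mem_runBlocks.1 hb'
    have hbb : b = b' := (hb₁ i hi).symm.trans (hb₁' i hi')
    subst hbb
    have him := mem_interval.1 hi
    have him' := mem_interval.1 hi'
    have hin := i.2
    constructor
    -- If `r` started earlier, the position just before `r'` would lie in `r` and carry the common
    -- bit, while maximality of `r'` forces the opposite bit there. The other end is symmetric.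
    · by_contra! hlt
      have h₁ := hb₁ ⟨r'.1 - 1, by omega⟩ (mem_interval.2 ⟨by simp only; omega, by simp only; omega⟩)
      have h₂ := hb₂' ⟨r'.1 - 1, by omega⟩ (Or.inl (by simp only; omega))
      rw [h₁] at h₂
      simp at h₂
    · by_contra! hlt
      have hn : r.1 + r.2 ≤ n := (mem_maxRuns.1 hr).1.2
      have h₁ := hb₁ ⟨r'.1 + r'.2, by omega⟩
        (mem_interval.2 ⟨by simp only; omega, by simp only; omega⟩)
      have h₂ := hb₂' ⟨r'.1 + r'.2, by omega⟩ (Or.inr rfl)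
      rw [h₁] at h₂
      simp at h₂
  intro r hr r' hr' hne
  rw [Function.onFun, Finset.disjoint_left]
  intro i hi hi'
  have h₁ := key hr hr' hi hi'
  have h₂ := key hr' hr hi' hi
  exact hne (Prod.ext (by omega) (by omega))

theorem sum_log_choose_le (x : Fin n → Bool) (S : Finset (Fin n)) :
    ∑ r ∈ maxRuns x, Real.log (r.2.choose (S ∩ run n r).card) ≤ Real.log (multiplicity x S) := by
  have hcard (r : ℕ × ℕ) (hr : r ∈ maxRuns x) : (run n r).card = r.2 := by
    rw [run, card_interval (mem_maxRuns.1 hr).1.2, Nat.add_sub_cancel_left]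
  have hpos (r : ℕ × ℕ) (hr : r ∈ maxRuns x) : 0 < r.2.choose (S ∩ run n r).card :=
    Nat.choose_pos ((Finset.card_le_card Finset.inter_subset_right).trans (hcard r hr).le)
  rw [← Real.log_prod fun r hr => by exact_mod_cast (hpos r hr).ne']
  refine Real.log_le_log (Finset.prod_pos fun r hr => by exact_mod_cast hpos r hr) ?_
  have h := prod_choose_le_multiplicity (x := x) (maxRuns x) (fun r hr => by
    obtain ⟨b, hb, -⟩ := mem_runBlocks.1 (mem_maxRuns.1 hr).2
    exact ⟨b, hb⟩) (pairwiseDisjoint_maxRuns x) S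
  rw [Finset.prod_congr rfl fun r hr => by rw [hcard r hr]] at h
  exact_mod_cast h

/-- The number of blocks for which a given run is maximal. -/
theorem card_runBlocks {s l : ℕ} (hl : 1 ≤ l) (hsl : s + l ≤ n) :
    (runBlocks n (s, l)).card = 2 * 2 ^ (n - (min n (s + l + 1) - (s - 1))) := by
  have hne : (⟨s, by omega⟩ : Fin n) ∈ run n (s, l) := mem_interval.2 ⟨le_rfl, by simp only; omega⟩
  -- The forced bits are those of the run and its neighbours, an interval clipped to the block by
  -- truncated subtraction on the left and `min` on the right.
  have hcard (b : Bool) : (Fintype.piFinset (runBits n (s, l) b)).card =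
      2 ^ (n - (min n (s + l + 1) - (s - 1))) := by
    have hb (i : Fin n) : (runBits n (s, l) b i).card =
        if i ∈ interval n (s - 1) (min n (s + l + 1)) then 1 else 2 := by
      have := i.2
      simp only [runBits, run, mem_interval]
      split_ifs <;> first | rfl | omega
    rw [Fintype.card_piFinset, Finset.prod_congr rfl fun i _ => hb i, Finset.prod_ite,
      Finset.prod_const_one, one_mul, Finset.prod_const]
    congr 1
    rw [Finset.filter_not, ← Finset.compl_eq_univ_sdiff, Finset.card_compl, Fintype.card_fin,
      Finset.filter_mem_eq_inter, Finset.univ_inter, card_interval (min_le_left _ _)]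
  rw [runBlocks, Finset.card_biUnion]
  · simp [hcard]
  · intro b _ b' _ hbb
    rw [Function.onFun, Finset.disjoint_left]
    intro x hx hx'
    have h₁ := Fintype.mem_piFinset.1 hx ⟨s, by omega⟩
    have h₂ := Fintype.mem_piFinset.1 hx' ⟨s, by omega⟩
    simp only [runBits, hne, if_true, Finset.mem_singleton] at h₁ h₂
    exact hbb (h₁.symm.trans h₂)

/-- The expected number of maximal runs of length `l < n` in a uniformly distributed block. -/
theorem sum_card_runBlocks {l : ℕ} (hl : 1 ≤ l) (hln : l < n) :
    (2 ^ n : ℝ)⁻¹ * ∑ s ∈ Finset.range (n - l + 1), ((runBlocks n (s, l)).card : ℝ) =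
      2 ^ (-(l : ℤ) - 1) * ((n : ℝ) - l + 3) := by
  obtain ⟨m, rfl⟩ : ∃ m, n = l + 1 + m := ⟨n - l - 1, by omega⟩
  -- Each of the `m = n - l - 1` interior positions admits `2 ^ m` blocks. A run at either end has
  -- one neighbour less and admits twice as many, so the total is `(m + 4) * 2 ^ m`, whence `n - l +
  -- 3`.
  have hmid (s : ℕ) (hs : s ∈ Finset.range m) :
      ((runBlocks (l + 1 + m) (s + 1, l)).card : ℝ) = 2 ^ m := by
    have hs := Finset.mem_range.1 hs
    rw [card_runBlocks hl (by omega)]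
    have : l + 1 + m - (min (l + 1 + m) (s + 1 + l + 1) - (s + 1 - 1)) = m - 1 := by omega
    rw [this, ← pow_succ', Nat.sub_add_cancel (by omega)]
    norm_num
  have hfirst : ((runBlocks (l + 1 + m) (0, l)).card : ℝ) = 2 * 2 ^ m := by
    rw [card_runBlocks hl (by omega)]
    have : l + 1 + m - (min (l + 1 + m) (0 + l + 1) - (0 - 1)) = m := by omega
    rw [this]
    norm_num
  have hlast : ((runBlocks (l + 1 + m) (m + 1, l)).card : ℝ) = 2 * 2 ^ m := by
    rw [card_runBlocks hl (by omega)]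
    have : l + 1 + m - (min (l + 1 + m) (m + 1 + l + 1) - (m + 1 - 1)) = m := by omega
    rw [this]
    norm_num
  have hr : l + 1 + m - l + 1 = m + 1 + 1 := by omega
  rw [hr, Finset.sum_range_succ, Finset.sum_range_succ', Finset.sum_congr rfl hmid, hfirst, hlast,
    Finset.sum_const, Finset.card_range, nsmul_eq_mul, zpow_sub₀ two_ne_zero, zpow_neg, zpow_one,
    zpow_natCast, pow_add, pow_add]
  push_cast
  field_simp
  ring

theorem sum_card_runBlocks_self (hn : 1 ≤ n) :
    (2 ^ n : ℝ)⁻¹ * ∑ s ∈ Finset.range (n - n + 1), ((runBlocks n (s, n)).card : ℝ) =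
      2 ^ (-(n : ℤ) + 1) := by
  have : n - (min n (0 + n + 1) - (0 - 1)) = 0 := by omega
  rw [Nat.sub_self, zero_add, Finset.sum_range_one, card_runBlocks hn (by omega), this,
    zpow_add₀ two_ne_zero, zpow_neg, zpow_one, zpow_natCast]
  norm_num

end Runs

/-! ### Averaging over runs and deletions to obtain the coefficients `W`. -/

section RunBound

variable {n : ℕ} {p : ℝ}

/-- The mean of `log (l.choose j)` for the number `j` of deletions in a set of `l` positions, as a
sum over the numbers of deletions in the block and in the set. -/
noncomputable def runMean (p : ℝ) (n l : ℕ) : ℝ :=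
  ∑ j ∈ Finset.Icc 1 n, p ^ j * (1 - p) ^ (n - j) * ∑ j' ∈ Finset.Icc 1 j,
    (l.choose j' : ℝ) * ((n - l).choose (j - j') : ℝ) * Real.log (l.choose j')

theorem sum_card_inter_card_sdiff (f : ℕ → ℕ → ℝ) (A : Finset (Fin n)) :
    ∑ T : Finset (Fin n), f (T ∩ A).card (T \ A).card =
      ∑ i ∈ Finset.range (A.card + 1), ∑ k ∈ Finset.range (n - A.card + 1),
        (A.card.choose i : ℝ) * ((n - A.card).choose k : ℝ) * f i k := by
  have hsplit : ∑ T : Finset (Fin n), f (T ∩ A).card (T \ A).card =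
      ∑ U ∈ A.powerset, ∑ V ∈ Aᶜ.powerset, f U.card V.card := by
    rw [← Finset.sum_product']
    refine Finset.sum_bij' (fun T _ => (T ∩ A, T \ A)) (fun q _ => q.1 ∪ q.2) ?_ ?_ ?_ ?_ ?_
    · intro T _
      simp only [Finset.mem_product, Finset.mem_powerset]
      exact ⟨Finset.inter_subset_right, fun i hi => by
        simpa using (Finset.mem_sdiff.1 hi).2⟩
    · simp
    · intro T _
      ext i
      simp only [Finset.mem_union, Finset.mem_inter, Finset.mem_sdiff]
      tauto
    · rintro ⟨U, V⟩ h
      simp only [Finset.mem_product, Finset.mem_powerset] at h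
      have hU (i) : i ∈ U → i ∈ A := fun hi => h.1 hi
      have hV (i) : i ∈ V → i ∉ A := fun hi => by simpa using h.2 hi
      ext i
      · have := hU i; have := hV i
        simp only [Finset.mem_inter, Finset.mem_union]; tauto
      · have := hU i; have := hV i
        simp only [Finset.mem_sdiff, Finset.mem_union]; tauto
    · simp
  rw [hsplit, Finset.sum_powerset_apply_card (fun i => ∑ V ∈ Aᶜ.powerset, f i V.card)]
  refine Finset.sum_congr rfl fun i _ => ?_
  rw [Finset.sum_powerset_apply_card (fun k => f i k), Finset.card_compl, Fintype.card_fin,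
    nsmul_eq_mul, Finset.mul_sum]
  exact Finset.sum_congr rfl fun k _ => by rw [nsmul_eq_mul, mul_assoc]

/-- Symmetry of binomial coefficients lets survivors be replaced by deletions, which are then
counted inside and outside `A` and regrouped by their total. -/
theorem sum_survivalProb_mul_log_choose (p : ℝ) (A : Finset (Fin n)) :
    ∑ S : Finset (Fin n), survivalProb p S * Real.log (A.card.choose (S ∩ A).card) =
      runMean p n A.card := by
  have hAn : A.card ≤ n := by simpa using A.card_le_univ
  set l := A.card with hl
  let f : ℕ → ℕ → ℝ := fun i k => p ^ (i + k) * (1 - p) ^ (n - (i + k)) * Real.log (l.choose i)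
  let g : ℕ → ℕ → ℝ := fun i k => (l.choose i : ℝ) * ((n - l).choose k : ℝ) * f i k
  have hcompl : ∑ S : Finset (Fin n), survivalProb p S * Real.log (l.choose (S ∩ A).card) =
      ∑ T : Finset (Fin n), f (T ∩ A).card (T \ A).card := by
    rw [← Equiv.sum_comp (compl_involutive (α := Finset (Fin n))).toPerm]
    refine Finset.sum_congr rfl fun T _ => ?_
    have h₁ : (Tᶜ ∩ A).card = l - (T ∩ A).card := by
      have := Finset.card_sdiff_add_card_inter A T
      have h' : Tᶜ ∩ A = A \ T := by ext i; simp [and_comm]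
      rw [h', Finset.inter_comm T A]
      omega
    have h₂ : (T ∩ A).card + (T \ A).card = T.card := by
      have := Finset.card_sdiff_add_card_inter T A
      omega
    have hTn : T.card ≤ n := by simpa using T.card_le_univ
    simp only [f, Function.Involutive.coe_toPerm, h₁, h₂]
    rw [survivalProb_eq_pow, Finset.card_compl, Fintype.card_fin, Nat.sub_sub_self hTn,
      Nat.choose_symm (Finset.card_le_card Finset.inter_subset_right), mul_comm (p ^ T.card)]
  have hzero {i : ℕ} (hi : l < i) (k : ℕ) : g i k = 0 := by simp [g, Nat.choose_eq_zero_of_lt hi]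
  have hzero' (i : ℕ) {k : ℕ} (hk : n - l < k) : g i k = 0 := by
    simp [g, Nat.choose_eq_zero_of_lt hk]
  rw [hcompl, sum_card_inter_card_sdiff]
  -- The rectangle is enlarged to a triangle, on whose additional points a binomial coefficient
  -- vanishes.
  have hdiag : ∑ i ∈ Finset.range (l + 1), ∑ k ∈ Finset.range (n - l + 1), g i k =
      ∑ j ∈ Finset.range (n + 1), ∑ i ∈ Finset.range (j + 1), g i (j - i) := by
    rw [Finset.sum_range_diag_flip]
    refine (Finset.sum_subset_zero_on_sdiff (Finset.range_subset_range.2 (by omega))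
      (fun i hi => ?_) fun i hi => ?_)
    · exact Finset.sum_eq_zero fun k _ => hzero (by simp at hi; omega) k
    · have := Finset.mem_range.1 hi
      refine Finset.sum_subset (Finset.range_subset_range.2 (by omega)) fun k _ hk => ?_
      exact hzero' i (by simp at hk; omega)
  refine hdiag.trans ?_
  have hIcc (m : ℕ) (F : ℕ → ℝ) (h0 : F 0 = 0) :
      ∑ j ∈ Finset.range (m + 1), F j = ∑ j ∈ Finset.Icc 1 m, F j := by
    symm
    refine Finset.sum_subset (fun j hj => ?_) fun j hj hj' => ?_
    · simp at hj ⊢; omega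
    · have : j = 0 := by simp at hj hj'; omega
      rw [this, h0]
  have hg0 (k : ℕ) : g 0 k = 0 := by simp [g, f]
  rw [hIcc n _ (by simp [hg0]), runMean]
  refine Finset.sum_congr rfl fun j _ => ?_
  rw [hIcc j _ (by simp [hg0]), Finset.mul_sum]
  refine Finset.sum_congr rfl fun i hi => ?_
  have : i + (j - i) = j := by simp at hi; omega
  simp only [g, f, this]
  ring

theorem sum_maxRuns (x : Fin n → Bool) (f : ℕ × ℕ → ℝ) :
    ∑ r ∈ maxRuns x, f r = ∑ l ∈ Finset.Icc 1 n, ∑ s ∈ Finset.range (n - l + 1),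
      if x ∈ runBlocks n (s, l) then f (s, l) else 0 := by
  rw [maxRuns, Finset.sum_filter, Finset.sum_image, runIndex, Finset.sum_sigma]
  rintro ⟨l, s⟩ _ ⟨l', s'⟩ _ h
  simp only [Prod.mk.injEq] at h
  rw [h.1, h.2]

/-- `runMean` depends on a run only through its length, so the average over inputs merely counts the
blocks in which each interval is a maximal run. -/
theorem sum_card_runBlocks_mul_runMean_le (hp₀ : 0 ≤ p) (hp₁ : p ≤ 1) (n : ℕ) :
    ∑ l ∈ Finset.Icc 1 n, ((2 ^ n : ℝ)⁻¹ * ∑ s ∈ Finset.range (n - l + 1),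
      ((runBlocks n (s, l)).card : ℝ)) * runMean p n l ≤ meanLogMultiplicity p n := by
  have hx (x : Fin n → Bool) : ∑ r ∈ maxRuns x, runMean p n r.2 ≤
      ∑ S, survivalProb p S * Real.log (multiplicity x S) := by
    have h := Finset.sum_le_sum fun S (_ : S ∈ Finset.univ) =>
      mul_le_mul_of_nonneg_left (sum_log_choose_le x S) (survivalProb_nonneg hp₀ hp₁ S)
    refine le_trans (le_of_eq ?_) h
    simp_rw [Finset.mul_sum]
    rw [Finset.sum_comm]
    refine Finset.sum_congr rfl fun r hr => ?_
    have hcard : (run n r).card = r.2 := by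
      rw [run, card_interval (mem_maxRuns.1 hr).1.2, Nat.add_sub_cancel_left]
    have := sum_survivalProb_mul_log_choose p (run n r)
    rw [hcard] at this
    exact this.symm
  rw [meanLogMultiplicity]
  refine le_trans (le_of_eq ?_) (mul_le_mul_of_nonneg_left
    (Finset.sum_le_sum fun x _ => hx x) (by positivity))
  simp_rw [sum_maxRuns]
  rw [Finset.sum_comm, Finset.mul_sum]
  refine Finset.sum_congr rfl fun l _ => ?_
  rw [Finset.sum_comm, mul_assoc, Finset.sum_mul]
  congr 1
  refine Finset.sum_congr rfl fun s _ => ?_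
  rw [← Finset.sum_filter, Finset.filter_mem_eq_inter, Finset.univ_inter, Finset.sum_const,
    nsmul_eq_mul]

theorem runMean_self (p : ℝ) (n : ℕ) : runMean p n n =
    ∑ j ∈ Finset.Icc 1 n, p ^ j * (1 - p) ^ (n - j) * ((n.choose j : ℝ) *
      Real.log (n.choose j)) := by
  refine Finset.sum_congr rfl fun j hj => ?_
  rw [Finset.sum_eq_single_of_mem j (by simp at hj ⊢; omega)]
  · simp
  · intro i hi hne
    have : 0 < j - i := by simp at hi; omega
    simp [Nat.choose_eq_zero_of_lt this]

theorem sum_W_mul_eq (p : ℝ) (n : ℕ) :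
    ∑ j ∈ Finset.Icc 1 n, W j n * (n.choose j : ℝ) * p ^ j * (1 - p) ^ (n - j) =
      (∑ l ∈ Finset.Icc 1 (n - 1), 2 ^ (-(l : ℤ) - 1) * ((n : ℝ) - l + 3) * runMean p n l +
        2 ^ (-(n : ℤ) + 1) * runMean p n n) / Real.log 2 := by
  rw [runMean_self]
  simp only [runMean, Finset.mul_sum]
  rw [Finset.sum_comm, ← Finset.sum_add_distrib, Finset.sum_div]
  refine Finset.sum_congr rfl fun j hj => ?_
  have hc : (n.choose j : ℝ) ≠ 0 := by
    have : 0 < n.choose j := Nat.choose_pos (Finset.mem_Icc.1 hj).2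
    positivity
  have hW : W j n * (n.choose j : ℝ) =
      ∑ l ∈ Finset.Icc 1 (n - 1), 2 ^ (-(l : ℤ) - 1) * ((n : ℝ) - l + 3) *
        ∑ j' ∈ Finset.Icc 1 j,
          (l.choose j' : ℝ) * ((n - l).choose (j - j') : ℝ) * Real.logb 2 (l.choose j' : ℝ)
      + (n.choose j : ℝ) * 2 ^ (-(n : ℤ) + 1) * Real.logb 2 (n.choose j : ℝ) := by
    rw [W]
    field_simp
  rw [hW, add_mul, add_mul, Finset.sum_mul, Finset.sum_mul, add_div, Finset.sum_div]
  congr 1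
  · refine Finset.sum_congr rfl fun l _ => ?_
    simp only [Finset.mul_sum, Finset.sum_mul, Finset.sum_div]
    refine Finset.sum_congr rfl fun j' _ => ?_
    rw [Real.logb]
    ring
  · rw [Real.logb]
    ring

theorem sum_W_mul_le (hp₀ : 0 ≤ p) (hp₁ : p ≤ 1) (hn : 1 ≤ n) :
    (∑ j ∈ Finset.Icc 1 n, W j n * (n.choose j : ℝ) * p ^ j * (1 - p) ^ (n - j)) * Real.log 2 ≤
      meanLogMultiplicity p n := by
  have h := sum_card_runBlocks_mul_runMean_le hp₀ hp₁ n
  obtain ⟨m, rfl⟩ : ∃ m, n = m + 1 := ⟨n - 1, by omega⟩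
  rw [sum_W_mul_eq, div_mul_cancel₀ _ (Real.log_pos one_lt_two).ne', Nat.add_sub_cancel]
  rw [Finset.sum_Icc_succ_top (by omega), sum_card_runBlocks_self (by omega),
    Finset.sum_congr rfl fun l hl => by
      rw [sum_card_runBlocks (Finset.mem_Icc.1 hl).1 (Nat.lt_succ_of_le (Finset.mem_Icc.1 hl).2)]]
    at h
  exact h

end RunBound

/-! ### Assembling the capacity bound. -/

section LowerBound

variable {p σ : ℝ} {n : ℕ}

theorem lowerBound_mul_le (hp₀ : 0 ≤ p) (hp₁ : p ≤ 1) (hσ : 0 < σ) (hn : 0 < n) (k : ℕ) :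
    lowerBound 1 p σ n * (k * n : ℕ) ≤ (maxMutualInfo p σ (k * n)).toReal := by
  have hlog := Real.log_pos one_lt_two
  have hn' : (n : ℝ) ≠ 0 := by positivity
  refine le_of_mul_le_mul_right ?_ hlog
  refine le_trans ?_ (le_maxMutualInfo hp₀ hp₁ σ (k * n))
  have h := (mul_le_mul_of_nonneg_left (sum_W_mul_le hp₀ hp₁ hn) k.cast_nonneg).trans
    (mul_meanLogMultiplicity_le hp₀ hp₁ k n)
  refine le_trans (le_of_eq ?_) (add_le_add_right h _)
  rw [toReal_symbolDiv hσ, lowerBound, Hb, Real.logb, Real.logb]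
  push_cast
  field_simp
  ring

theorem lowerBound_zero_le_one (hp₁ : p ≤ 1) : lowerBound 0 p σ n ≤ lowerBound 1 p σ n :=
  sub_le_sub_left (mul_le_mul_of_nonneg_left (gaussianLogMean_one_le_zero σ) (by linarith)) _

end LowerBound

end DelAWGN

theorem mainTheorem4 (p σ : ℝ) (hp₀ : 0 ≤ p) (hp₁ : p ≤ 1) (hσ : 0 < σ) :
    Tendsto (fun N : ℕ => DelAWGN.maxMutualInfo p σ N / (N : ℝ≥0∞)) atTop
        (𝓝 (DelAWGN.capacity p σ)) ∧
      DelAWGN.capacity p σ ≠ ∞ ∧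
      ∀ n : ℕ, 0 < n →
        DelAWGN.lowerBound 1 p σ n ≤ (DelAWGN.capacity p σ).toReal ∧
        DelAWGN.lowerBound 0 p σ n ≤ (DelAWGN.capacity p σ).toReal := by
  obtain ⟨L, hL, hcap, hreal, htend⟩ := DelAWGN.exists_tendsto_maxMutualInfo_div hp₀ hp₁ σ
  refine ⟨htend, hcap ▸ ENNReal.ofReal_ne_top, fun n hn => ?_⟩
  have hle : DelAWGN.lowerBound 1 p σ n ≤ (DelAWGN.capacity p σ).toReal := by
    rw [hcap, ENNReal.toReal_ofReal hL]
    -- The full limit exists, so it may be evaluated along block lengths divisible by `n`.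
    have hmul : Tendsto (fun k : ℕ => k * n) atTop atTop :=
      tendsto_id.atTop_mul_const' hn
    refine ge_of_tendsto (hreal.comp hmul) ?_
    filter_upwards [eventually_gt_atTop 0] with k hk
    have hkn : (0 : ℝ) < (k * n : ℕ) := by exact_mod_cast Nat.mul_pos hk hn
    rw [Function.comp_apply, le_div_iff₀ hkn]
    exact DelAWGN.lowerBound_mul_le hp₀ hp₁ hσ hn k
  exact ⟨hle, (DelAWGN.lowerBound_zero_le_one hp₁).trans hle⟩
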